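/- **Setting.** Let $G=(V,E)$ be a finite graph with vertex connectivity $k$, let $L\ge 0$ and $t\ge 1$ be integers, and read $L/2$ as $\lfloor L/2\rfloor$. The virtual graph $\mathcal G$ has, for every $v\in V$, one virtual node for each layer number in $\{1,\dots,L\}$ and each type number in $\{1,2,3\}$; two distinct virtual nodes are adjacent if they belong to the same vertex of $G$ or to two adjacent vertices of $G$. The virtual nodes are assigned to classes $1,\dots,t$ layer by layer. Let $\mathcal V^i_\ell$ be the set of virtual nodes of layers $1,\dots,\ell$ in class $i$, let $N^i_\ell$ be the number of connected components of $\mathcal G[\mathcal V^i_\ell]$, and let $M_\ell=\sum_{i=1}^t (N^i_\ell-1)$. Each virtual node of layers $1,\dots,L/2$ joins an independent, uniformly random class. For $\ell=L/2,\dots,L-1$, the nodes of layer $\ell+1$ (the new nodes) are then assigned as follows. 1. Each new node of type 1 or 3 joins an independent, uniformly random class. 2. The bridging graph is the bipartite graph between the components of the graphs $\mathcal G[\mathcal V^i_\ell]$, $1\le i\le t$, and the type-2 new nodes, in which a type-2 new node $v$ is adjacent to a component $\mathcal C$ of $\mathcal G[\mathcal V^i_\ell]$ if (a) $v$ has a neighbor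 in $\mathcal C$; (b) no type-1 new node that joined class $i$ has both a neighbor in $\mathcal C$ and a neighbor in another component of $\mathcal G[\mathcal V^i_\ell]$; and (c) $v$ has a type-3 new neighbor that joined class $i$ and has a neighbor in a component of $\mathcal G[\mathcal V^i_\ell]$ other than $\mathcal C$. 3. A maximal (with respect to inclusion) matching of the bridging graph is found by an arbitrary, possibly randomized, rule. Each matched type-2 new node joins the class of its matched component; each unmatched one joins an independent, uniformly random class. Let $D$ be the event that for every class $i$, $\mathcal V^i_{L/2}$ is a dominating set of $\mathcal G$. **Lemma (Fast Merger Lemma).** For every constant $c>0$ there are constants $\delta>0$ and $\rho\in(0,1]$, depending only on $c$, such that the following holds for all $G$, $L$, $t$ as above with $1\le t\le c\,k$, and for every matching rule. * On the event $D$, $M_{\ell+1}\le M_\ell$ for every $\ell\in[L/2,L-1]$. * For every $\ell\in[L/2,L-1]$ and every assignment $b$ of the layers $1,\dots,\ell$ that occurs with positive probability and for which $D$ holds, $$\Pr\big[M_{\ell+1}\le(1-\delta)M_\ell \,\big|\, \text{layers } 1,\dots,\ell \text{ are assigned by } b\big]\ge\rho .$$ * Moreover, the layers succeed at least as often as independent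 trials: for every upward closed family $\mathcal U$ of sets of integers, the set of those $\ell\in[L/2,L-1]$ with $M_{\ell+1}\le(1-\delta)M_\ell$ satisfies $$\Pr\big[D \text{ and } \{\ell : M_{\ell+1}\le(1-\delta)M_\ell\}\in\mathcal U\big]\ \ge\ \Pr[D]\cdot\Pr[R\in\mathcal U],$$ where $R\subseteq[L/2,L-1]$ is a random set that contains each integer of $[L/2,L-1]$ independently with probability $\rho$. -/

import Mathlib

namespace FastMerger

open scoped Classical in
/-- The vertex connectivity of a finite graph: the largest `k` such that `G` has more than `k`
vertices and stays connected after the deletion of any fewer than `k` vertices. In particular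
the complete graph on `n` vertices has vertex connectivity `n - 1`. -/
noncomputable def vertexConnectivity {V : Type*} [Fintype V] (G : SimpleGraph V) : ℕ :=
  sSup {k : ℕ | k < Fintype.card V ∧
    ∀ S : Finset V, S.card < k → (G.induce {v | v ∉ S}).Connected}

/-- Virtual nodes: every real node has exactly one virtual node for each layer number in
`{1, …, L}` and each type number in `{1, 2, 3}`. -/
abbrev VNode (V : Type*) (L : ℕ) := V × Fin L × Fin 3

section Nodes
variable {V : Type*} {L : ℕ}

/-- The real node that simulates a virtual node. -/
def realNode (x : VNode V L) : V := x.1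

/-- The layer number, in `{1, …, L}`. -/
def layerNo (x : VNode V L) : ℕ := x.2.1.val + 1

/-- The type number, in `{1, 2, 3}`. -/
def typeNo (x : VNode V L) : ℕ := x.2.2.val + 1

/-- The virtual graph: two different virtual nodes are adjacent if they are simulated by the
same real node or by two adjacent real nodes. -/
def virtualGraph (G : SimpleGraph V) (L : ℕ) : SimpleGraph (VNode V L) where
  Adj x y := x ≠ y ∧ (realNode x = realNode y ∨ G.Adj (realNode x) (realNode y))
  symm := ⟨fun _ _ h => ⟨h.1.symm, h.2.imp Eq.symm (fun e => e.symm)⟩⟩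
  loopless := ⟨fun _ h => h.1 rfl⟩

end Nodes

/-- A (partial) assignment of the virtual nodes to the classes `0, …, t - 1`;
`none` means that the node has not joined a class yet. -/
abbrev Assignment (V : Type*) (L t : ℕ) := VNode V L → Option (Fin t)

section Components
variable {V : Type*} {L t : ℕ}

/-- The set of virtual nodes of layers `1, …, ℓ` that are assigned to class `i`. -/
def classSet (a : Assignment V L t) (ℓ : ℕ) (i : Fin t) : Set (VNode V L) :=
  {x | layerNo x ≤ ℓ ∧ a x = some i}

/-- The part of an assignment that concerns layers `1, …, ℓ`. -/
def upTo (a : Assignment V L t) (ℓ : ℕ) : Assignment V L t :=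
  fun x => if layerNo x ≤ ℓ then a x else none

/-- The connected components of the subgraph of the virtual graph that is induced by the nodes
of layers `1, …, ℓ` in class `i`. -/
abbrev Comp (G : SimpleGraph V) (a : Assignment V L t) (ℓ : ℕ) (i : Fin t) :=
  ((virtualGraph G L).induce (classSet a ℓ i)).ConnectedComponent

/-- `M_ℓ = ∑ i, (N_ℓ^i - 1)`, where `N_ℓ^i` is the number of components of class `i`. -/
noncomputable def excess (G : SimpleGraph V) (a : Assignment V L t) (ℓ : ℕ) : ℤ :=
  ∑ i : Fin t, ((Nat.card (Comp G a ℓ i) : ℤ) - 1)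

/-- `S` is a dominating set of the graph `H`. -/
def IsDominating {W : Type*} (H : SimpleGraph W) (S : Set W) : Prop :=
  ∀ x, x ∉ S → ∃ y ∈ S, H.Adj x y

/-- Every class, restricted to layers `1, …, L / 2`, dominates the virtual graph. -/
def HalfDominating (G : SimpleGraph V) (a : Assignment V L t) : Prop :=
  ∀ i : Fin t, IsDominating (virtualGraph G L) (classSet a (L / 2) i)

/-- The virtual node `x` has a neighbor in the component `C`. -/
def HasNbrIn (G : SimpleGraph V) (a : Assignment V L t) (ℓ : ℕ) {i : Fin t}
    (x : VNode V L) (C : Comp G a ℓ i) : Prop :=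
  ∃ y : classSet a ℓ i,
    ((virtualGraph G L).induce (classSet a ℓ i)).connectedComponentMk y = C ∧
      (virtualGraph G L).Adj x y

/-- `x` is a new node (that is, of layer `ℓ + 1`) of type `r`. -/
def IsNew (ℓ r : ℕ) (x : VNode V L) : Prop := layerNo x = ℓ + 1 ∧ typeNo x = r

/-- The condition under which the type-2 new node `v` and the component `C` of class `i` are
adjacent in the bridging graph. Here `a` is the assignment in which the nodes of layers
`1, …, ℓ` and the new nodes of types 1 and 3 have joined their classes. -/
def Bridges (G : SimpleGraph V) (a : Assignment V L t) (ℓ : ℕ) {i : Fin t}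
    (C : Comp G a ℓ i) (v : VNode V L) : Prop :=
  HasNbrIn G a ℓ v C ∧
  (¬ ∃ u, IsNew ℓ 1 u ∧ a u = some i ∧ HasNbrIn G a ℓ u C ∧
      ∃ C' : Comp G a ℓ i, C' ≠ C ∧ HasNbrIn G a ℓ u C') ∧
  ∃ w, IsNew ℓ 3 w ∧ a w = some i ∧ (virtualGraph G L).Adj v w ∧
      ∃ C'' : Comp G a ℓ i, C'' ≠ C ∧ HasNbrIn G a ℓ w C''

/-- The vertices of the bridging graph: the components of the old nodes of all the classes,
and the type-2 new nodes. -/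
abbrev BridgeVertex (G : SimpleGraph V) (a : Assignment V L t) (ℓ : ℕ) :=
  (Σ i : Fin t, Comp G a ℓ i) ⊕ {x : VNode V L // IsNew ℓ 2 x}

/-- The bipartite bridging graph. -/
def bridgingGraph (G : SimpleGraph V) (a : Assignment V L t) (ℓ : ℕ) :
    SimpleGraph (BridgeVertex G a ℓ) :=
  SimpleGraph.fromRel fun p q =>
    ∃ (C : Σ i : Fin t, Comp G a ℓ i) (v : {x : VNode V L // IsNew ℓ 2 x}),
      p = Sum.inl C ∧ q = Sum.inr v ∧ Bridges G a ℓ C.2 v.1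

/-- The maximal (with respect to inclusion) matchings of a graph. -/
abbrev MaximalMatching {W : Type*} (H : SimpleGraph W) :=
  {M : H.Subgraph // Maximal (fun M : H.Subgraph => M.IsMatching) M}

/-- `M` matches the virtual node `x` to the component `C`. -/
def MatchedTo {G : SimpleGraph V} {a : Assignment V L t} {ℓ : ℕ}
    (M : (bridgingGraph G a ℓ).Subgraph) (C : Σ i : Fin t, Comp G a ℓ i) (x : VNode V L) : Prop :=
  ∃ hx : IsNew ℓ 2 x, M.Adj (Sum.inl C) (Sum.inr ⟨x, hx⟩)

/-- A way of finding a maximal matching of the bridging graph: for each `ℓ` and each assignment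
of the nodes of layers `1, …, ℓ` and the type-1 and type-3 nodes of layer `ℓ + 1`, a (possibly
random) maximal matching of the corresponding bridging graph. -/
abbrev MatchingRule (G : SimpleGraph V) (L t : ℕ) :=
  (ℓ : ℕ) → (a : Assignment V L t) → PMF (MaximalMatching (bridgingGraph G a ℓ))

open scoped Classical in
/-- Every node matched by `M` joins the class of the component it is matched to. -/
noncomputable def joinMatched {G : SimpleGraph V} {a : Assignment V L t} {ℓ : ℕ}
    (M : (bridgingGraph G a ℓ).Subgraph) : Assignment V L t :=
  fun x => if h : ∃ C, MatchedTo M C x then some h.choose.1 else a x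

end Components

section RandomAssignment
variable {V : Type*} [Fintype V] {L t : ℕ} [NeZero t]

open scoped Classical in
/-- Every node of `S` joins an independent, uniformly random class. -/
noncomputable def joinRandom (S : Set (VNode V L)) (a : Assignment V L t) :
    PMF (Assignment V L t) :=
  (PMF.uniformOfFintype (VNode V L → Fin t)).map fun c x => if x ∈ S then some (c x) else a x

/-- The recursive class assignment of layer `ℓ + 1`, given the assignment of layers
`1, …, ℓ`: the new nodes of types 1 and 3 join random classes, a maximal matching of the bridging
graph is found, the matched type-2 new nodes join the classes of their components, and the
unmatched type-2 new nodes join random classes. -/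
noncomputable def recursiveStep {G : SimpleGraph V} (rule : MatchingRule G L t) (ℓ : ℕ)
    (a : Assignment V L t) : PMF (Assignment V L t) :=
  (joinRandom {x | IsNew ℓ 1 x ∨ IsNew ℓ 3 x} a).bind fun a₁ =>
    (rule ℓ a₁).bind fun M =>
      joinRandom {x | IsNew ℓ 2 x ∧ ¬ ∃ C, MatchedTo M.1 C x} (joinMatched M.1)

/-- The law of the assignment after layers `1, …, ℓ` have been assigned. Layers `1, …, L / 2` are
assigned uniformly at random, the later ones by the recursive step. -/
noncomputable def run {G : SimpleGraph V} (rule : MatchingRule G L t) :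
    ℕ → PMF (Assignment V L t)
  | 0 => PMF.pure fun _ => none
  | ℓ + 1 => (run rule ℓ).bind fun a =>
      if ℓ + 1 ≤ L / 2 then joinRandom {x | layerNo x = ℓ + 1} a else recursiveStep rule ℓ a

end RandomAssignment

/-- The probability of an event under a discrete distribution. -/
noncomputable def prob {α : Type*} (p : PMF α) (E : Set α) : ℝ := (p.toOuterMeasure E).toReal

/-- The step from layer `ℓ` to layer `ℓ + 1` is successful:
`M_{ℓ+1} ≤ (1 - δ) M_ℓ`. -/
def Success {V : Type*} {L t : ℕ} (G : SimpleGraph V) (δ : ℝ) (a : Assignment V L t)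
    (ℓ : ℕ) : Prop :=
  (excess G a (ℓ + 1) : ℝ) ≤ (1 - δ) * (excess G a ℓ : ℝ)

open scoped Classical in
/-- The set of the successful steps `ℓ ∈ [L / 2, L - 1]`. -/
noncomputable def successSet {V : Type*} {L t : ℕ} (G : SimpleGraph V) (δ : ℝ)
    (a : Assignment V L t) : Finset ℕ :=
  {ℓ ∈ Finset.Ico (L / 2) L | Success G δ a ℓ}

open scoped Classical in
/-- The probability that the set of successful trials belongs to `U`, for independent trials
indexed by `I`, each of which succeeds with probability `ρ`. -/
noncomputable def independentTrials (ρ : ℝ) (I : Finset ℕ) (U : Set (Finset ℕ)) : ℝ :=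
  ∑ A ∈ I.powerset with A ∈ U, ρ ^ A.card * (1 - ρ) ^ (I \ A).card

end FastMerger

/-! Because the old nodes of every class dominate, each new node of a class is adjacent to an old
component of that class. Hence the old components map onto the new ones, the excess cannot grow, and
if every component in a set `Z` is identified with another one, the excess drops by at least `|Z| /
2` (`two_mul_card_add_card_le`). It remains to merge a constant fraction of the components with
constant probability.

Fix a component `C` whose class has other components. The vertices seeing `C` and those seeing
another component of the class cover the graph. By a Menger-type argument
(`exists_matching_of_cover`) either many vertices see both, or a large matching leads from vertices
seeing only `C` to vertices seeing another component. This gives about `k / 4` connectors of `C`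
(`exists_connectors`): single type-1 nodes, or type-3 nodes paired with a type-2 node. A connector
is active if its type-1 or type-3 node joins the class of `C`, which has probability `1 / t`.

For every maximal matching, the merged components and the matched type-2 nodes, which are no more
numerous, form a vertex cover of the active connectors (`exists_cover_of_step`). So it suffices that
the active connectors have no small cover. A second-moment bound (`exists_cover_bound`) gives a
lower bound `Φ` for the size of any cover, with average at least a constant times the excess. Since
`Φ` is at most four times the excess, it is large with constant probability
(`card_filter_of_average`). As `Φ` depends only on the random classes of types 1 and 3, the matching
rule plays no role.

The bound holds from every dominating history, so an induction over the layers, for all upward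
closed families at once, compares the successes with independent trials (`StepBound.dominates`). -/

namespace FastMerger

/-! ### Components under enlargement of a vertex set -/

section Merging
variable {W : Type*} (H : SimpleGraph W) {S S' : Set W}

/-- The component of a larger induced subgraph that contains a given component. -/
def compMap (h : S ⊆ S') :
    (H.induce S).ConnectedComponent → (H.induce S').ConnectedComponent :=
  SimpleGraph.ConnectedComponent.map (H.induceHomOfLE h).toHom

variable {H}

theorem compMap_mk (h : S ⊆ S') (x : S) :
    compMap H h ((H.induce S).connectedComponentMk x) =
      (H.induce S').connectedComponentMk ⟨x, h x.2⟩ := rfl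

theorem compMap_mk_eq_of_adj (h : S ⊆ S') {u : W} (hu : u ∈ S') (x : S) (hux : H.Adj u x) :
    compMap H h ((H.induce S).connectedComponentMk x) =
      (H.induce S').connectedComponentMk ⟨u, hu⟩ := by
  rw [compMap_mk]
  refine SimpleGraph.ConnectedComponent.sound (SimpleGraph.Adj.reachable ?_)
  exact hux.symm

/-- Domination attaches each added vertex to an old component, so no component consists of added
vertices only. -/
theorem compMap_surjective (h : S ⊆ S') (dom : ∀ x ∈ S', x ∉ S → ∃ y ∈ S, H.Adj x y) :
    Function.Surjective (compMap H h) := by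
  intro C
  induction C using SimpleGraph.ConnectedComponent.ind with
  | h x =>
    obtain ⟨x, hx⟩ := x
    by_cases hxS : x ∈ S
    · exact ⟨(H.induce S).connectedComponentMk ⟨x, hxS⟩, rfl⟩
    · obtain ⟨y, hy, hxy⟩ := dom x hx hxS
      exact ⟨(H.induce S).connectedComponentMk ⟨y, hy⟩, compMap_mk_eq_of_adj h hx ⟨y, hy⟩ hxy⟩

/-- If every element of `Z` is identified with another element by a surjection, then the
surjection decreases the cardinality by at least half the size of `Z`. -/
theorem two_mul_card_add_card_le {K K' : Type*} [Fintype K] [Fintype K'] [DecidableEq K']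
    (f : K → K') (hf : Function.Surjective f) (Z : Finset K)
    (hZ : ∀ C ∈ Z, ∃ C', C' ≠ C ∧ f C' = f C) :
    2 * Fintype.card K' + Z.card ≤ 2 * Fintype.card K := by
  classical
  have h1 : Fintype.card K = ∑ k' : K', (Finset.univ.filter fun k => f k = k').card := by
    rw [← Finset.card_univ]
    exact Finset.card_eq_sum_card_fiberwise (fun _ _ => Finset.mem_coe.2 (Finset.mem_univ _))
  have h2 : Z.card = ∑ k' : K', (Z.filter fun k => f k = k').card :=
    Finset.card_eq_sum_card_fiberwise (fun _ _ => Finset.mem_coe.2 (Finset.mem_univ _))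
  have h3 : 2 * Fintype.card K' = ∑ _k' : K', 2 := by simp [mul_comm]
  -- Compare fibre by fibre: a fibre of size `n` meeting `Z` has `n ≥ 2`, so `2 + n ≤ 2 * n`; a
  -- fibre missing `Z` needs only `n ≥ 1`.
  rw [h1, h2, h3, ← Finset.sum_add_distrib, Finset.mul_sum]
  refine Finset.sum_le_sum fun k' _ => ?_
  have hsub : (Z.filter fun k => f k = k').card ≤ (Finset.univ.filter fun k => f k = k').card :=
    Finset.card_le_card (Finset.filter_subset_filter _ (Finset.subset_univ _))
  rcases Finset.eq_empty_or_nonempty (Z.filter fun k => f k = k') with h0 | ⟨C, hC⟩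
  · obtain ⟨k, hk⟩ := hf k'
    have : 0 < (Finset.univ.filter fun k => f k = k').card :=
      Finset.card_pos.2 ⟨k, by simp [hk]⟩
    rw [h0]
    simp only [Finset.card_empty]
    omega
  · rw [Finset.mem_filter] at hC
    obtain ⟨C', hne, hC'⟩ := hZ C hC.1
    have : 1 < (Finset.univ.filter fun k => f k = k').card :=
      Finset.one_lt_card.2 ⟨C', by simp [hC', hC.2], C, by simp [hC.2], hne⟩
    omega

end Merging

/-! ### Vertex connectivity and matchings between covering sets -/

section Connectivity
variable {V : Type*} [Fintype V] {G : SimpleGraph V}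

theorem vertexConnectivity_spec (h : 0 < vertexConnectivity G) :
    vertexConnectivity G < Fintype.card V ∧
      ∀ S : Finset V, S.card < vertexConnectivity G → (G.induce {v | v ∉ S}).Connected := by
  refine Nat.sSup_mem (s := {k : ℕ | k < Fintype.card V ∧
    ∀ S : Finset V, S.card < k → (G.induce {v | v ∉ S}).Connected}) ?_
    ⟨Fintype.card V, fun k hk => hk.1.le⟩
  by_contra hne
  rw [Set.not_nonempty_iff_eq_empty] at hne
  have : vertexConnectivity G = 0 := by
    unfold vertexConnectivity
    rw [hne]
    simp
  omega

theorem exists_adj_of_connected_induce {V : Type*} {G : SimpleGraph V} {X : Finset V} (hX : (G.induce {v | v ∉ X}).Connected)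
    {P : Set V} {p q : V} (hpX : p ∉ X) (hqX : q ∉ X) (hp : p ∈ P) (hq : q ∉ P) :
    ∃ a b, a ∉ X ∧ b ∉ X ∧ G.Adj a b ∧ a ∈ P ∧ b ∉ P := by
  obtain ⟨w⟩ := hX.preconnected ⟨p, hpX⟩ ⟨q, hqX⟩
  obtain ⟨d, -, h1, h2⟩ := w.exists_boundary_dart {x | (x : V) ∈ P} hp hq
  exact ⟨d.fst, d.snd, d.fst.2, d.snd.2, d.adj, h1, h2⟩

/-- If `X` contained the closed neighborhood of `p`, deleting `X` without `p` would isolate `p` from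
the vertices outside `X`. -/
theorem exists_mem_closed_nbhd_notMem (hk : 0 < vertexConnectivity G) (p : V) {X : Finset V}
    (hX : X.card < vertexConnectivity G) : ∃ q, (q = p ∨ G.Adj q p) ∧ q ∉ X := by
  classical
  obtain ⟨hcard, hconn⟩ := vertexConnectivity_spec hk
  by_contra! hall
  have hpX : p ∈ X := hall p (Or.inl rfl)
  have hlt : (X.erase p).card < vertexConnectivity G :=
    lt_of_le_of_lt (Finset.card_le_card (Finset.erase_subset _ _)) hX
  obtain ⟨z, hz⟩ : ∃ z, z ∉ X := by
    by_contra! h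
    have : X = Finset.univ := Finset.eq_univ_iff_forall.2 h
    rw [this, Finset.card_univ] at hX
    omega
  have hzp : z ≠ p := fun h => hz (h ▸ hpX)
  obtain ⟨a, b, -, hb, hab, ha, hb'⟩ := exists_adj_of_connected_induce (hconn _ hlt) (P := {p})
    (p := p) (q := z) (by simp) (fun h => hz (Finset.mem_of_mem_erase h)) rfl hzp
  rw [Set.mem_singleton_iff] at ha hb'
  subst ha
  exact hb (Finset.mem_erase.2 ⟨hb', hall b (Or.inr hab.symm)⟩)

/-- Two sets that cover the graph and contain closed neighborhoods either have a large
intersection or are joined by a large matching outside of their intersection. -/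
theorem exists_matching_of_cover [DecidableEq V] (hk : 0 < vertexConnectivity G) {P Q : Finset V}
    (hPQ : ∀ v, v ∈ P ∨ v ∈ Q) {p q : V} (hP : ∀ v, v = p ∨ G.Adj v p → v ∈ P)
    (hQ : ∀ v, v = q ∨ G.Adj v q → v ∈ Q) :
    ∃ T : Finset (V × V), (∀ e ∈ T, e.1 ∉ Q ∧ e.2 ∈ Q ∧ e.1 ∈ P ∧ G.Adj e.1 e.2) ∧
      Set.InjOn Prod.fst (T : Set (V × V)) ∧ Set.InjOn Prod.snd (T : Set (V × V)) ∧
      vertexConnectivity G ≤ (P ∩ Q).card + 2 * T.card := by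
  classical
  obtain ⟨hcard, hconn⟩ := vertexConnectivity_spec hk
  let good : Finset (V × V) → Prop := fun T =>
    (∀ e ∈ T, e.1 ∉ Q ∧ e.2 ∈ Q ∧ e.1 ∈ P ∧ G.Adj e.1 e.2) ∧
      Set.InjOn Prod.fst (T : Set (V × V)) ∧ Set.InjOn Prod.snd (T : Set (V × V))
  obtain ⟨T, hT, hmax⟩ := Finset.exists_max_image (Finset.univ.filter good) Finset.card
    ⟨∅, by simp [good]⟩
  rw [Finset.mem_filter] at hT
  obtain ⟨hT1, hT2, hT3⟩ := hT.2
  refine ⟨T, hT1, hT2, hT3, ?_⟩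
  by_contra! hlt
  -- If the bound fails, this set is too small to separate the graph. An edge leaving `P` outside
  -- `X` then starts in `P \ Q`, ends in `Q`, and extends the maximal matching `T`.
  set X := (P ∩ Q) ∪ (T.image Prod.fst ∪ T.image Prod.snd) with hXdef
  have hX : X.card < vertexConnectivity G := by
    have h1 := Finset.card_union_le (P ∩ Q) (T.image Prod.fst ∪ T.image Prod.snd)
    have h2 := Finset.card_union_le (T.image Prod.fst) (T.image Prod.snd)
    have h3 := Finset.card_image_le (s := T) (f := Prod.fst)
    have h4 := Finset.card_image_le (s := T) (f := Prod.snd)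
    rw [hXdef]
    omega
  obtain ⟨p', hp', hp'X⟩ := exists_mem_closed_nbhd_notMem hk p hX
  obtain ⟨q', hq', hq'X⟩ := exists_mem_closed_nbhd_notMem hk q hX
  have hq'P : q' ∉ P := fun h =>
    hq'X (Finset.mem_union_left _ (Finset.mem_inter.2 ⟨h, hQ _ hq'⟩))
  obtain ⟨a, b, haX, hbX, hab, ha, hb⟩ := exists_adj_of_connected_induce (hconn X hX)
    (P := {v | v ∈ P}) hp'X hq'X (hP _ hp') hq'P
  have hbQ : b ∈ Q := (hPQ b).resolve_left hb
  have haQ : a ∉ Q := fun h => haX (Finset.mem_union_left _ (Finset.mem_inter.2 ⟨ha, h⟩))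
  have haT : ∀ e ∈ T, e.1 ≠ a := fun e he h => haX (Finset.mem_union_right _
    (Finset.mem_union_left _ (Finset.mem_image.2 ⟨e, he, h⟩)))
  have hbT : ∀ e ∈ T, e.2 ≠ b := fun e he h => hbX (Finset.mem_union_right _
    (Finset.mem_union_right _ (Finset.mem_image.2 ⟨e, he, h⟩)))
  have hnot : (a, b) ∉ T := fun h => haT _ h rfl
  have hgood : good (insert (a, b) T) := by
    refine ⟨?_, ?_, ?_⟩
    · intro e he
      rcases Finset.mem_insert.1 he with rfl | he
      · exact ⟨haQ, hbQ, ha, hab⟩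
      · exact hT1 e he
    · rw [Finset.coe_insert, Set.injOn_insert (by simpa using hnot)]
      refine ⟨hT2, ?_⟩
      rintro ⟨e, he, h⟩
      exact haT e he h
    · rw [Finset.coe_insert, Set.injOn_insert (by simpa using hnot)]
      refine ⟨hT3, ?_⟩
      rintro ⟨e, he, h⟩
      exact hbT e he h
  have := hmax _ (Finset.mem_filter.2 ⟨Finset.mem_univ _, hgood⟩)
  rw [Finset.card_insert_of_notMem hnot] at this
  omega

end Connectivity

/-! ### Second-moment bound for covers of active hyperedges -/

section Averaging
variable {ε W P : Type*} [Fintype W] [DecidableEq W] [Fintype P] {t : ℕ} [NeZero t]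

open scoped Classical in
theorem card_colorings_eq (x : W) (i : Fin t) :
    ((Finset.univ.filter fun c : W → Fin t => c x = i).card : ℝ) =
      Fintype.card (W → Fin t) / t := by
  have h : ∀ j : Fin t, (Finset.univ.filter fun c : W → Fin t => c x = j).card =
      (Finset.univ.filter fun c : W → Fin t => c x = i).card := by
    intro j
    refine Finset.card_bij' (fun c _ => Function.update c x i) (fun c _ => Function.update c x j)
      ?_ ?_ ?_ ?_ <;> simp +contextual
  have hsum : Fintype.card (W → Fin t) =
      ∑ j : Fin t, (Finset.univ.filter fun c : W → Fin t => c x = j).card := by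
    rw [← Finset.card_univ]
    exact Finset.card_eq_sum_card_fiberwise (fun _ _ => Finset.mem_coe.2 (Finset.mem_univ _))
  rw [Finset.sum_congr rfl fun j _ => h j] at hsum
  simp only [Finset.sum_const, Finset.card_univ, Fintype.card_fin, smul_eq_mul] at hsum
  have ht : (t : ℝ) ≠ 0 := by exact_mod_cast NeZero.ne t
  rw [hsum]
  push_cast
  field_simp

open scoped Classical in
theorem card_colorings_eq_two {x y : W} (hxy : x ≠ y) (i j : Fin t) :
    ((Finset.univ.filter fun c : W → Fin t => c x = i ∧ c y = j).card : ℝ) =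
      Fintype.card (W → Fin t) / t / t := by
  have h : ∀ j' : Fin t, (Finset.univ.filter fun c : W → Fin t => c x = i ∧ c y = j').card =
      (Finset.univ.filter fun c : W → Fin t => c x = i ∧ c y = j).card := by
    intro j'
    refine Finset.card_bij' (fun c _ => Function.update c y j) (fun c _ => Function.update c y j')
      ?_ ?_ ?_ ?_ <;> simp +contextual [hxy]
  have hsum : (Finset.univ.filter fun c : W → Fin t => c x = i).card =
      ∑ j' : Fin t, (Finset.univ.filter fun c : W → Fin t => c x = i ∧ c y = j').card := by
    rw [Finset.card_eq_sum_card_fiberwise (f := fun c => c y) (t := Finset.univ)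
      (fun _ _ => Finset.mem_coe.2 (Finset.mem_univ _))]
    simp only [Finset.filter_filter]
  rw [Finset.sum_congr rfl fun j _ => h j] at hsum
  simp only [Finset.sum_const, Finset.card_univ, Fintype.card_fin, smul_eq_mul] at hsum
  have ht : (t : ℝ) ≠ 0 := by exact_mod_cast NeZero.ne t
  rw [← card_colorings_eq x i, hsum]
  push_cast
  field_simp

open scoped Classical in
/-- A hypergraph whose edges become active when their activators get the right color has, on
average over all colorings, no small vertex cover of the active edges. -/
theorem exists_cover_bound (E : Finset ε) (act : ε → W) (col : ε → Fin t) (D : P → Finset ε)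
    (hD : ∀ p, (D p).card ≤ t)
    (hpair : ∀ p, ∀ e ∈ D p, ∀ e' ∈ D p, e ≠ e' → act e ≠ act e' ∨ col e ≠ col e')
    (hsum : ∑ p, (D p).card ≤ 2 * E.card) :
    ∃ Φ : (W → Fin t) → ℝ,
      (∀ c (Z : Finset P), (∀ e ∈ E, c (act e) = col e → ∃ p ∈ Z, e ∈ D p) → Φ c ≤ Z.card) ∧
      (E.card / (4 * t) * Fintype.card (W → Fin t) : ℝ) ≤ ∑ c, Φ c := by
  have ht : (0 : ℝ) < t := by exact_mod_cast NeZero.pos t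
  let A : (W → Fin t) → Finset ε → Finset ε := fun c F => F.filter fun e => c (act e) = col e
  let N : ℝ := Fintype.card (W → Fin t)
  -- Half the active edges, minus a penalty for vertices with many active edges. The mean is at
  -- least `|E| / (2t) - (2|E| / t) / 8 = |E| / (4t)`.
  refine ⟨fun c => (A c E).card / 2 - (∑ p, ((A c (D p)).offDiag.card : ℝ)) / 8, ?_, ?_⟩
  · intro c Z hZ
    have h1 : ((A c E).card : ℝ) ≤ ∑ p ∈ Z, ((A c (D p)).card : ℝ) := by
      have : A c E ⊆ Z.biUnion fun p => A c (D p) := by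
        intro e he
        rw [Finset.mem_filter] at he
        obtain ⟨p, hp, hep⟩ := hZ e he.1 he.2
        exact Finset.mem_biUnion.2 ⟨p, hp, Finset.mem_filter.2 ⟨hep, he.2⟩⟩
      exact_mod_cast (Finset.card_le_card this).trans Finset.card_biUnion_le
    -- With `x` active edges at `p` this is `x ≤ 2 + x(x - 1) / 4`: beyond two edges, the ordered
    -- pairs pay.
    have h2 : ∀ p, ((A c (D p)).card : ℝ) ≤ 2 + ((A c (D p)).offDiag.card : ℝ) / 4 := by
      intro p
      rw [Finset.offDiag_card, Nat.cast_sub (Nat.le_mul_self _)]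
      push_cast
      nlinarith [sq_nonneg (2 * ((A c (D p)).card : ℝ) - 5)]
    have h3 : ∑ p ∈ Z, ((A c (D p)).card : ℝ) ≤
        2 * Z.card + (∑ p, ((A c (D p)).offDiag.card : ℝ)) / 4 := by
      calc _ ≤ ∑ p ∈ Z, (2 + ((A c (D p)).offDiag.card : ℝ) / 4) :=
            Finset.sum_le_sum fun p _ => h2 p
        _ = 2 * Z.card + (∑ p ∈ Z, ((A c (D p)).offDiag.card : ℝ)) / 4 := by
            rw [Finset.sum_add_distrib, Finset.sum_const, nsmul_eq_mul, Finset.sum_div]; ring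
        _ ≤ _ := by
            have := Finset.sum_le_univ_sum_of_nonneg (s := Z)
              (f := fun p => ((A c (D p)).offDiag.card : ℝ)) (fun p => Nat.cast_nonneg _)
            linarith
    simp only
    linarith
  · have h1 : ∑ c, ((A c E).card : ℝ) = E.card * (N / t) := by
      have : ∀ c, ((A c E).card : ℝ) = ∑ e ∈ E, if c (act e) = col e then (1 : ℝ) else 0 := by
        intro c; simp [A]
      simp_rw [this]
      rw [Finset.sum_comm, ← nsmul_eq_mul, ← Finset.sum_const]
      refine Finset.sum_congr rfl fun e _ => ?_
      rw [← card_colorings_eq (act e) (col e)]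
      simp
    have h2 : ∀ p, ∑ c, ((A c (D p)).offDiag.card : ℝ) ≤ (D p).card * (N / t) := by
      intro p
      have h : ∀ c, ((A c (D p)).offDiag.card : ℝ) = ∑ q ∈ (D p).offDiag,
          if c (act q.1) = col q.1 ∧ c (act q.2) = col q.2 then (1 : ℝ) else 0 := by
        intro c
        rw [Finset.sum_boole]
        congr 2
        ext q
        simp only [A, Finset.mem_offDiag, Finset.mem_filter]
        tauto
      simp_rw [h]
      rw [Finset.sum_comm]
      have hN : 0 ≤ N / t / t := by positivity
      have hq : ∀ q ∈ (D p).offDiag, (∑ c : W → Fin t,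
          if c (act q.1) = col q.1 ∧ c (act q.2) = col q.2 then (1 : ℝ) else 0) ≤ N / t / t := by
        intro q hq
        obtain ⟨hq1, hq2, hne⟩ := Finset.mem_offDiag.1 hq
        rw [Finset.sum_boole]
        -- Two edges with the same activator need different colors and are never active together;
        -- otherwise their activations are independent.
        by_cases hact : act q.1 = act q.2
        · have hcol := (hpair p _ hq1 _ hq2 hne).resolve_left (fun h => h hact)
          rw [Finset.filter_false_of_mem]
          · simpa using hN
          · rintro c - ⟨h1, h2⟩
            exact hcol (by rw [← h1, ← h2, hact])
        · exact (card_colorings_eq_two hact _ _).le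
      refine (Finset.sum_le_sum hq).trans ?_
      rw [Finset.sum_const, nsmul_eq_mul]
      have hcard : ((D p).offDiag.card : ℝ) ≤ (D p).card * t := by
        rw [Finset.offDiag_card]
        exact_mod_cast (Nat.sub_le _ _).trans (Nat.mul_le_mul_left _ (hD p))
      calc _ ≤ (D p).card * t * (N / t / t) := mul_le_mul_of_nonneg_right hcard hN
        _ = _ := by field_simp
    have h3 : ∑ c, ∑ p, ((A c (D p)).offDiag.card : ℝ) ≤ 2 * E.card * (N / t) := by
      rw [Finset.sum_comm]
      refine (Finset.sum_le_sum fun p _ => h2 p).trans ?_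
      rw [← Finset.sum_mul]
      refine mul_le_mul_of_nonneg_right ?_ (by positivity)
      exact_mod_cast hsum
    rw [Finset.sum_sub_distrib, ← Finset.sum_div, ← Finset.sum_div, h1]
    have h4 : (E.card / (4 * t) * N : ℝ) = E.card * (N / t) / 4 := by field_simp
    change (E.card / (4 * t) * N : ℝ) ≤ _
    rw [h4]
    linarith

/-- A bounded function with a large average is often large. -/
theorem card_filter_of_average {Ω : Type*} [Fintype Ω] (Φ : Ω → ℝ) {α X : ℝ} (hα : 0 ≤ α) (hX : 0 < X)
    (hub : ∀ c, Φ c ≤ 4 * X) (havg : α * X * Fintype.card Ω ≤ ∑ c, Φ c) {S : Set Ω}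
    [DecidablePred (· ∈ S)]
    (hS : ∀ c, α / 2 * X ≤ Φ c → c ∈ S) :
    α / 8 * Fintype.card Ω ≤ ((Finset.univ.filter (· ∈ S)).card : ℝ) := by
  have h : ∀ c, Φ c ≤ α / 2 * X + if c ∈ S then (4 - α / 2) * X else 0 := by
    intro c
    split_ifs with hc
    · linarith [hub c]
    · have := lt_of_not_ge fun h => hc (hS c h)
      linarith
  have h2 := havg.trans (Finset.sum_le_sum fun c _ => h c)
  rw [Finset.sum_add_distrib, ← Finset.sum_filter, Finset.sum_const, Finset.sum_const,
    nsmul_eq_mul, nsmul_eq_mul, Finset.card_univ] at h2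
  set s : ℝ := ((Finset.univ.filter (· ∈ S)).card : ℝ)
  have hs : 0 ≤ s := Nat.cast_nonneg _
  have h3 : X * (α / 8 * Fintype.card Ω) ≤ X * s := by
    nlinarith [mul_nonneg hs (mul_nonneg hα hX.le)]
  exact le_of_mul_le_mul_left h3 hX

end Averaging

/-! ### Elementary facts on discrete distributions -/

section Probability
variable {α β : Type*}

theorem prob_nonneg (p : PMF α) (E : Set α) : 0 ≤ prob p E := ENNReal.toReal_nonneg

theorem outerMeasure_ne_top (p : PMF α) (E : Set α) : p.toOuterMeasure E ≠ ⊤ :=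
  ne_top_of_le_ne_top ENNReal.one_ne_top <|
    ((p.toOuterMeasure.mono (Set.subset_univ E))).trans
      ((PMF.toOuterMeasure_apply_eq_one_iff p _).2 (Set.subset_univ _)).le

theorem prob_mono (p : PMF α) {E F : Set α} (h : ∀ a ∈ p.support, a ∈ E → a ∈ F) :
    prob p E ≤ prob p F :=
  ENNReal.toReal_mono (outerMeasure_ne_top p F)
    (PMF.toOuterMeasure_mono p fun a ha => h a ha.2 ha.1)

theorem prob_congr (p : PMF α) {E F : Set α} (h : ∀ a ∈ p.support, a ∈ E ↔ a ∈ F) :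
    prob p E = prob p F :=
  le_antisymm (prob_mono p fun a ha => (h a ha).1) (prob_mono p fun a ha => (h a ha).2)

theorem prob_eq_one (p : PMF α) {E : Set α} (h : ∀ a ∈ p.support, a ∈ E) : prob p E = 1 := by
  unfold prob
  rw [(PMF.toOuterMeasure_apply_eq_one_iff p E).2 h, ENNReal.toReal_one]

theorem prob_map (p : PMF α) (f : α → β) (E : Set β) : prob (p.map f) E = prob p (f ⁻¹' E) := by
  unfold prob
  rw [PMF.toOuterMeasure_map_apply]

theorem prob_bind [Fintype α] (p : PMF α) (f : α → PMF β) (E : Set β) :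
    prob (p.bind f) E = ∑ a, (p a).toReal * prob (f a) E := by
  unfold prob
  rw [PMF.toOuterMeasure_bind_apply, tsum_fintype, ENNReal.toReal_sum]
  · simp only [ENNReal.toReal_mul]
  · exact fun a _ => ENNReal.mul_ne_top (p.apply_ne_top a) (outerMeasure_ne_top _ _)

open scoped Classical in
theorem prob_eq_sum [Fintype α] (p : PMF α) (E : Set α) :
    prob p E = ∑ a, if a ∈ E then (p a).toReal else 0 := by
  unfold prob
  rw [PMF.toOuterMeasure_apply_fintype, ENNReal.toReal_sum]
  · refine Finset.sum_congr rfl fun a _ => ?_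
    by_cases h : a ∈ E <;> simp [h]
  · exact fun a _ => ne_top_of_le_ne_top (p.apply_ne_top a) (Set.indicator_le_self _ _ _)

theorem prob_le_prob_bind [Fintype α] (p : PMF α) (f : α → PMF β) {A : Set α} {E : Set β}
    (h : ∀ a ∈ A, ∀ b ∈ (f a).support, b ∈ E) : prob p A ≤ prob (p.bind f) E := by
  classical
  rw [prob_bind, prob_eq_sum]
  refine Finset.sum_le_sum fun a _ => ?_
  split_ifs with ha
  · rw [prob_eq_one _ (h a ha), mul_one]
  · exact mul_nonneg ENNReal.toReal_nonneg (prob_nonneg _ _)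

open scoped Classical in
theorem prob_uniformOfFintype [Fintype α] [Nonempty α] (A : Set α) :
    prob (PMF.uniformOfFintype α) A = (Finset.univ.filter (· ∈ A)).card / Fintype.card α := by
  rw [prob_eq_sum, ← Finset.sum_filter]
  simp [div_eq_mul_inv]

end Probability

/-! ### Dependence of the process on its first layers -/

section Layers
variable {V : Type*} {L t : ℕ}

theorem upTo_apply {a : Assignment V L t} {ℓ : ℕ} {x : VNode V L} (h : layerNo x ≤ ℓ) :
    upTo a ℓ x = a x := if_pos h

theorem upTo_apply_of_lt {a : Assignment V L t} {ℓ : ℕ} {x : VNode V L} (h : ℓ < layerNo x) :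
    upTo a ℓ x = none := if_neg (not_le.2 h)

theorem upTo_upTo (a : Assignment V L t) {m n : ℕ} (h : m ≤ n) :
    upTo (upTo a n) m = upTo a m := by
  funext x
  by_cases hx : layerNo x ≤ m
  · rw [upTo_apply hx, upTo_apply hx, upTo_apply (hx.trans h)]
  · rw [upTo_apply_of_lt (not_le.1 hx), upTo_apply_of_lt (not_le.1 hx)]

theorem classSet_upTo (a : Assignment V L t) {m n : ℕ} (h : m ≤ n) :
    classSet (upTo a n) m = classSet a m := by
  funext i
  ext x
  simp only [classSet, Set.mem_ofPred_eq]
  exact and_congr_right fun hx => by rw [upTo_apply (hx.trans h)]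

theorem classSet_eq_of_eqOn {a a' : Assignment V L t} {ℓ : ℕ}
    (h : ∀ x, layerNo x ≤ ℓ → a' x = a x) : classSet a' ℓ = classSet a ℓ := by
  funext i
  ext x
  simp only [classSet, Set.mem_ofPred_eq]
  exact and_congr_right fun hx => by rw [h x hx]

theorem classSet_mono (a : Assignment V L t) {m n : ℕ} (h : m ≤ n) (i : Fin t) :
    classSet a m i ⊆ classSet a n i := fun _ hx => ⟨hx.1.trans h, hx.2⟩

theorem excess_congr (G : SimpleGraph V) {a a' : Assignment V L t} {ℓ : ℕ}
    (h : classSet a' ℓ = classSet a ℓ) : excess G a' ℓ = excess G a ℓ := by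
  unfold excess
  exact Finset.sum_congr rfl fun i _ => congrArg (fun S : Set (VNode V L) =>
    ((Nat.card ((virtualGraph G L).induce S).ConnectedComponent : ℤ) - 1)) (congrFun h i)

theorem halfDominating_congr {G : SimpleGraph V} {a a' : Assignment V L t}
    (h : classSet a' (L / 2) = classSet a (L / 2)) : HalfDominating G a' ↔ HalfDominating G a := by
  unfold HalfDominating
  rw [h]

theorem success_congr {G : SimpleGraph V} {δ : ℝ} {a a' : Assignment V L t} {ℓ : ℕ}
    (h : classSet a' ℓ = classSet a ℓ) (h' : classSet a' (ℓ + 1) = classSet a (ℓ + 1)) :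
    Success G δ a' ℓ ↔ Success G δ a ℓ := by
  unfold Success
  rw [excess_congr G h, excess_congr G h']

theorem joinMatched_apply_of_not_isNew {G : SimpleGraph V} {a : Assignment V L t} {ℓ : ℕ}
    (M : (bridgingGraph G a ℓ).Subgraph) {x : VNode V L} (hx : ¬ IsNew ℓ 2 x) :
    joinMatched M x = a x := by
  unfold joinMatched
  rw [dif_neg]
  rintro ⟨C, h, -⟩
  exact hx h

variable [Fintype V] [NeZero t]

theorem mem_support_joinRandom {S : Set (VNode V L)} {a a' : Assignment V L t}
    (h : a' ∈ (joinRandom S a).support) {x : VNode V L} (hx : x ∉ S) : a' x = a x := by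
  classical
  rw [joinRandom, PMF.mem_support_map_iff] at h
  obtain ⟨c, -, rfl⟩ := h
  simp [hx]

/-- The transition from layer `ℓ` to layer `ℓ + 1`. -/
noncomputable def layerStep {G : SimpleGraph V} (rule : MatchingRule G L t) (ℓ : ℕ)
    (a : Assignment V L t) : PMF (Assignment V L t) :=
  if ℓ + 1 ≤ L / 2 then joinRandom {x | layerNo x = ℓ + 1} a else recursiveStep rule ℓ a

variable {G : SimpleGraph V} (rule : MatchingRule G L t)

theorem run_succ (ℓ : ℕ) : run rule (ℓ + 1) = (run rule ℓ).bind (layerStep rule ℓ) := rfl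

theorem mem_support_recursiveStep {ℓ : ℕ} {a a' : Assignment V L t}
    (h : a' ∈ (recursiveStep rule ℓ a).support) {x : VNode V L} (hx : layerNo x ≠ ℓ + 1) :
    a' x = a x := by
  simp only [recursiveStep, PMF.mem_support_bind_iff] at h
  obtain ⟨a₁, h₁, M, -, h⟩ := h
  rw [mem_support_joinRandom h fun h' => hx h'.1.1,
    joinMatched_apply_of_not_isNew _ fun h' => hx h'.1,
    mem_support_joinRandom h₁ fun h' => hx (h'.elim And.left And.left)]

theorem mem_support_layerStep {ℓ : ℕ} {a a' : Assignment V L t}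
    (h : a' ∈ (layerStep rule ℓ a).support) {x : VNode V L} (hx : layerNo x ≠ ℓ + 1) :
    a' x = a x := by
  unfold layerStep at h
  split_ifs at h
  · exact mem_support_joinRandom h hx
  · exact mem_support_recursiveStep rule h hx

theorem upTo_of_mem_support_run {n : ℕ} {a : Assignment V L t} (h : a ∈ (run rule n).support) :
    upTo a n = a := by
  induction n generalizing a with
  | zero =>
    simp only [run, PMF.support_pure, Set.mem_singleton_iff] at h
    subst h
    funext x
    simp [upTo]
  | succ n ih =>
    rw [run_succ, PMF.mem_support_bind_iff] at h
    obtain ⟨b, hb, ha⟩ := h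
    funext x
    by_cases hx : layerNo x ≤ n + 1
    · rw [upTo_apply hx]
    · rw [upTo_apply_of_lt (not_le.1 hx), mem_support_layerStep rule ha (by omega), ← ih hb,
        upTo_apply_of_lt (by omega)]

theorem upTo_of_mem_support_layerStep {ℓ n : ℕ} (hn : n ≤ ℓ) {a a' : Assignment V L t}
    (h : a' ∈ (layerStep rule ℓ a).support) : upTo a' n = upTo a n := by
  funext x
  by_cases hx : layerNo x ≤ n
  · rw [upTo_apply hx, upTo_apply hx, mem_support_layerStep rule h (by omega)]
  · rw [upTo_apply_of_lt (not_le.1 hx), upTo_apply_of_lt (not_le.1 hx)]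

/-- The first layers have the same law in the whole process as in the process that is stopped
after them. -/
theorem prob_run_upTo {m n : ℕ} (h : m ≤ n) (E : Set (Assignment V L t)) :
    prob (run rule n) {a | upTo a m ∈ E} = prob (run rule m) E := by
  classical
  induction n, h using Nat.le_induction with
  | base => exact prob_congr _ fun a ha => by rw [Set.mem_ofPred_eq, upTo_of_mem_support_run rule ha]
  | succ n hmn ih =>
    rw [← ih, run_succ, prob_bind, prob_eq_sum]
    refine Finset.sum_congr rfl fun a _ => ?_
    split_ifs with ha
    · rw [prob_eq_one, mul_one]
      intro a' ha'
      rw [Set.mem_ofPred_eq, upTo_of_mem_support_layerStep rule hmn ha']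
      exact ha
    · rw [show prob (layerStep rule n a) {a | upTo a m ∈ E} = 0 from ?_, mul_zero]
      unfold prob
      rw [(PMF.toOuterMeasure_apply_eq_zero_iff _ _).2, ENNReal.toReal_zero]
      rw [Set.disjoint_left]
      intro a' ha' h'
      rw [Set.mem_ofPred_eq, upTo_of_mem_support_layerStep rule hmn ha'] at h'
      exact ha h'

/-! ### Histories and stochastic domination -/

/-- A lower bound for the success probability of one layer, given its history. -/
def StepBound (δ ρ : ℝ) : Prop :=
  ∀ ℓ ∈ Finset.Ico (L / 2) L, ∀ b : Assignment V L t, HalfDominating G b →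
    ρ ≤ prob (layerStep rule ℓ b) {a | Success G δ a ℓ}

variable {rule} {δ ρ : ℝ}

theorem StepBound.history (h : StepBound rule δ ρ) {ℓ : ℕ} (hℓ : ℓ ∈ Finset.Ico (L / 2) L)
    {b : Assignment V L t} (hb : HalfDominating G b) :
    ρ * prob (run rule L) {a | upTo a ℓ = b} ≤
      prob (run rule L) {a | upTo a ℓ = b ∧ Success G δ a ℓ} := by
  classical
  have hℓL := (Finset.mem_Ico.1 hℓ).2
  have e1 : prob (run rule L) {a | upTo a ℓ = b} = prob (run rule ℓ) {b} :=
    prob_run_upTo rule hℓL.le {b}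
  have e2 : prob (run rule L) {a | upTo a ℓ = b ∧ Success G δ a ℓ} =
      prob (run rule (ℓ + 1)) {a | upTo a ℓ = b ∧ Success G δ a ℓ} := by
    rw [← prob_run_upTo rule hℓL]
    refine prob_congr _ fun a _ => ?_
    simp only [Set.mem_ofPred_eq]
    rw [upTo_upTo _ (Nat.le_succ ℓ), success_congr (classSet_upTo a (Nat.le_succ ℓ))
      (classSet_upTo a le_rfl)]
  rw [e1, e2, run_succ, prob_bind, prob_eq_sum, Finset.mul_sum]
  refine Finset.sum_le_sum fun a _ => ?_
  split_ifs with ha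
  · by_cases hs : a ∈ (run rule ℓ).support
    · rw [mul_comm]
      refine mul_le_mul_of_nonneg_left ?_ ENNReal.toReal_nonneg
      rw [Set.mem_singleton_iff] at ha
      subst ha
      refine (h ℓ hℓ a hb).trans (prob_mono _ fun a' ha' hsucc => ⟨?_, hsucc⟩)
      rw [upTo_of_mem_support_layerStep rule le_rfl ha', upTo_of_mem_support_run rule hs]
    · rw [(PMF.apply_eq_zero_iff _ _).2 hs]
      simp
  · rw [mul_zero]
    exact mul_nonneg ENNReal.toReal_nonneg (prob_nonneg _ _)

open scoped Classical in
/-- The set of the successful steps before step `n`. -/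
noncomputable def successSetBelow (G : SimpleGraph V) (δ : ℝ) (a : Assignment V L t) (n : ℕ) :
    Finset ℕ :=
  {ℓ ∈ Finset.Ico (L / 2) n | Success G δ a ℓ}

open scoped Classical in
theorem independentTrials_succ (ρ : ℝ) {m n : ℕ} (hmn : m ≤ n) (U : Set (Finset ℕ)) :
    independentTrials ρ (Finset.Ico m (n + 1)) U =
      (1 - ρ) * independentTrials ρ (Finset.Ico m n) U +
        ρ * independentTrials ρ (Finset.Ico m n) {A | insert n A ∈ U} := by
  have hn : n ∉ Finset.Ico m n := by simp
  unfold independentTrials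
  rw [← Finset.insert_Ico_right_eq_Ico_add_one hmn]
  simp only [Finset.sum_filter]
  rw [Finset.sum_powerset_insert hn, Finset.mul_sum, Finset.mul_sum]
  congr 1
  · refine Finset.sum_congr rfl fun A hA => ?_
    have hnA : n ∉ A := fun h => hn (Finset.mem_powerset.1 hA h)
    split_ifs
    · rw [Finset.insert_sdiff_of_notMem _ hnA, Finset.card_insert_of_notMem (by simp)]
      ring
    · ring
  · refine Finset.sum_congr rfl fun A hA => ?_
    have hnA : n ∉ A := fun h => hn (Finset.mem_powerset.1 hA h)
    simp only [Set.mem_ofPred_eq]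
    split_ifs
    · rw [Finset.insert_sdiff_insert, Finset.card_insert_of_notMem hnA,
        Finset.sdiff_insert_of_notMem hn]
      ring
    · ring

/-- The last step is revealed after the others. A past success set in `U` stays good whatever
happens, and one that needs the last success gets it with probability at least `ρ`. The induction
needs all `U` at once, since it is also applied to `U'`. -/
theorem StepBound.dominates (h : StepBound rule δ ρ) (hρ : 0 ≤ ρ) (hρ1 : ρ ≤ 1) {n : ℕ}
    (hn : L / 2 ≤ n) (hnL : n ≤ L) (U : Set (Finset ℕ)) (hU : IsUpperSet U) :
    independentTrials ρ (Finset.Ico (L / 2) n) U *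
        prob (run rule n) {a | HalfDominating G a} ≤
      prob (run rule n) {a | HalfDominating G a ∧ successSetBelow G δ a n ∈ U} := by
  classical
  induction n, hn using Nat.le_induction generalizing U with
  | base =>
    have hs : ∀ a : Assignment V L t, successSetBelow G δ a (L / 2) = ∅ := by
      simp [successSetBelow]
    by_cases hU0 : ∅ ∈ U <;> simp [independentTrials, hs, Finset.sum_filter, hU0, prob_nonneg]
  | succ n hn ih =>
    specialize ih (by omega)
    set U' : Set (Finset ℕ) := {A | insert n A ∈ U} with hU'def
    have hU' : IsUpperSet U' := fun A B hAB hA => hU (Finset.insert_subset_insert n hAB) hA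
    have hUU' : U ⊆ U' := fun A hA => hU (Finset.subset_insert n A) hA
    have i1 := ih U hU
    have i2 := ih U' hU'
    have hD : prob (run rule (n + 1)) {a | HalfDominating G a} =
        prob (run rule n) {a | HalfDominating G a} := by
      rw [← prob_run_upTo rule (Nat.le_succ n)]
      refine prob_congr _ fun a _ => ?_
      rw [Set.mem_ofPred_eq, Set.mem_ofPred_eq, Set.mem_ofPred_eq,
        halfDominating_congr (classSet_upTo a hn)]
    rw [independentTrials_succ ρ hn, hD]
    refine le_trans (b := (1 - ρ) *
      prob (run rule n) {a | HalfDominating G a ∧ successSetBelow G δ a n ∈ U} + ρ *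
      prob (run rule n) {a | HalfDominating G a ∧ successSetBelow G δ a n ∈ U'}) ?_ ?_
    · have j1 := mul_le_mul_of_nonneg_left i1 (sub_nonneg.2 hρ1)
      have j2 := mul_le_mul_of_nonneg_left i2 hρ
      nlinarith
    rw [run_succ, prob_bind, prob_eq_sum, prob_eq_sum, Finset.mul_sum, Finset.mul_sum,
      ← Finset.sum_add_distrib]
    refine Finset.sum_le_sum fun a _ => ?_
    have hp : 0 ≤ (run rule n a).toReal := ENNReal.toReal_nonneg
    have hfacts : ∀ a' ∈ (layerStep rule n a).support,
        (HalfDominating G a' ↔ HalfDominating G a) ∧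
        successSetBelow G δ a' n = successSetBelow G δ a n ∧
        successSetBelow G δ a' (n + 1) = if Success G δ a' n then
          insert n (successSetBelow G δ a n) else successSetBelow G δ a n := by
      intro a' ha'
      have hcl : ∀ m ≤ n, classSet a' m = classSet a m := fun m hm =>
        classSet_eq_of_eqOn fun x hx => mem_support_layerStep rule ha' (by omega)
      have h2 : successSetBelow G δ a' n = successSetBelow G δ a n := by
        unfold successSetBelow
        refine Finset.filter_congr fun m hm => ?_
        have := (Finset.mem_Ico.1 hm).2
        exact success_congr (hcl m this.le) (hcl (m + 1) this)
      refine ⟨halfDominating_congr (hcl _ hn), h2, ?_⟩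
      rw [← h2]
      unfold successSetBelow
      rw [← Finset.insert_Ico_right_eq_Ico_add_one hn, Finset.filter_insert]
    by_cases hDa : HalfDominating G a
    swap
    · simp only [Set.mem_ofPred_eq, hDa, false_and, if_false, mul_zero, add_zero]
      exact mul_nonneg hp (prob_nonneg _ _)
    by_cases hUa : successSetBelow G δ a n ∈ U
    · simp only [Set.mem_ofPred_eq, hDa, true_and, hUa, if_true, hUU' hUa]
      rw [prob_eq_one, mul_one]
      · linarith
      · intro a' ha'
        obtain ⟨h1, -, h3⟩ := hfacts a' ha'
        refine ⟨h1.2 hDa, ?_⟩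
        rw [h3]
        split_ifs
        exacts [hUU' hUa, hUa]
    · simp only [Set.mem_ofPred_eq, hDa, true_and, hUa, if_false, mul_zero, zero_add]
      split_ifs with hUa'
      · rw [mul_comm]
        refine mul_le_mul_of_nonneg_left ?_ hp
        refine (h n (Finset.mem_Ico.2 ⟨hn, by omega⟩) a hDa).trans
          (prob_mono _ fun a' ha' hsucc => ?_)
        obtain ⟨h1, -, h3⟩ := hfacts a' ha'
        rw [Set.mem_ofPred_eq] at hsucc
        rw [if_pos hsucc] at h3
        exact ⟨h1.2 hDa, by rw [h3]; exact hUa'⟩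
      · rw [mul_zero]
        exact mul_nonneg hp (prob_nonneg _ _)

end Layers

/-! ### Connectors of a component -/

section Connectors
variable {V : Type*} {L : ℕ} {G : SimpleGraph V}

/-- The components of the subgraph of the virtual graph that is induced by `S`. -/
abbrev SetComp (G : SimpleGraph V) (S : Set (VNode V L)) :=
  ((virtualGraph G L).induce S).ConnectedComponent

/-- The virtual node `x` has a neighbor in the component `C`. -/
def NbrIn (G : SimpleGraph V) {S : Set (VNode V L)} (x : VNode V L) (C : SetComp G S) : Prop :=
  ∃ y : S, ((virtualGraph G L).induce S).connectedComponentMk y = C ∧ (virtualGraph G L).Adj x y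

/-- The virtual node of layer `ℓ + 1` and type `r + 1` at the vertex `v`. -/
def newNode {ℓ : ℕ} (hℓ : ℓ < L) (r : Fin 3) (v : V) : VNode V L := (v, ⟨ℓ, hℓ⟩, r)

theorem isNew_newNode {ℓ : ℕ} (hℓ : ℓ < L) (r : Fin 3) (v : V) :
    IsNew ℓ (r + 1) (newNode hℓ r v) := ⟨rfl, rfl⟩

variable {S : Set (VNode V L)} {ℓ : ℕ}

theorem nbrIn_newNode_iff (hS : ∀ y ∈ S, layerNo y ≤ ℓ) (hℓ : ℓ < L) (r : Fin 3) (v : V)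
    (C : SetComp G S) : NbrIn G (newNode hℓ r v) C ↔
      ∃ y : S, ((virtualGraph G L).induce S).connectedComponentMk y = C ∧
        (v = realNode y.1 ∨ G.Adj v (realNode y.1)) := by
  refine exists_congr fun y => and_congr_right fun _ => ?_
  refine ⟨fun h => h.2, fun h => ⟨?_, h⟩⟩
  intro h
  have h1 := hS _ y.2
  rw [← h] at h1
  exact absurd h1 (Nat.not_succ_le_self ℓ)

/-- A potential connector of the component `C` to another component of `S`, together with the
type-2 node that it needs: either a type-1 new node that has neighbors in `C` and in another
component, or a type-3 new node with a neighbor in another component and a type-2 new neighbor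
that has neighbors in `C` only. -/
def IsConnector (G : SimpleGraph V) (hℓ : ℓ < L) (C : SetComp G S)
    (e : Option V × VNode V L) : Prop :=
  (IsNew ℓ 1 e.2 ∧ e.1 = none ∧ NbrIn G e.2 C ∧ ∃ C', C' ≠ C ∧ NbrIn G e.2 C') ∨
    (IsNew ℓ 3 e.2 ∧ ∃ v, e.1 = some v ∧ (virtualGraph G L).Adj (newNode hℓ 1 v) e.2 ∧
      NbrIn G (newNode hℓ 1 v) C ∧ (∀ C', NbrIn G (newNode hℓ 1 v) C' → C' = C) ∧
      ∃ C', C' ≠ C ∧ NbrIn G e.2 C')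

theorem IsConnector.isNew {hℓ : ℓ < L} {C : SetComp G S} {e : Option V × VNode V L}
    (h : IsConnector G hℓ C e) : IsNew ℓ 1 e.2 ∨ IsNew ℓ 3 e.2 := h.imp And.left And.left

/-- The type-2 node of a connector sees only one component of the class. Hence it serves at most one
component per class, which later bounds its degree by `t`. -/
theorem IsConnector.comp_eq {hℓ : ℓ < L} {C C' : SetComp G S} {e e' : Option V × VNode V L}
    {v : V} (h : IsConnector G hℓ C e) (h' : IsConnector G hℓ C' e') (he : e.1 = some v)
    (he' : e'.1 = some v) : C = C' := by
  rcases h with ⟨-, h, -⟩ | ⟨-, w, hw, -, hC, -, -⟩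
  · simp [h] at he
  rcases h' with ⟨-, h, -⟩ | ⟨-, w', hw', -, -, hC', -⟩
  · simp [h] at he'
  obtain rfl : w = v := by simpa [hw] using he
  obtain rfl : w' = w := by simpa [hw'] using he'
  exact hC' C hC

/-- Every component of a dominating set has many connectors to the other components. -/
theorem exists_connectors [Fintype V] (hk : 0 < vertexConnectivity G) (hℓ : ℓ < L)
    (hS : ∀ y ∈ S, layerNo y ≤ ℓ) (hdom : IsDominating (virtualGraph G L) S)
    (C : SetComp G S) (hC : ∃ C' : SetComp G S, C' ≠ C) {s : ℕ}
    (hs : 4 * s ≤ vertexConnectivity G + 3) :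
    ∃ E : Finset (Option V × VNode V L), (∀ e ∈ E, IsConnector G hℓ C e) ∧ E.card = s ∧
      Set.InjOn Prod.snd (E : Set (Option V × VNode V L)) ∧
      ∀ e ∈ E, ∀ e' ∈ E, ∀ v, e.1 = some v → e'.1 = some v → e = e' := by
  classical
  obtain ⟨C₁, hC₁⟩ := hC
  have hr : ∀ (r r' : Fin 3) (v : V) (C : SetComp G S),
      NbrIn G (newNode hℓ r v) C ↔ NbrIn G (newNode hℓ r' v) C := fun r r' v C => by
    rw [nbrIn_newNode_iff hS, nbrIn_newNode_iff hS]
  let P : Finset V := Finset.univ.filter fun v => NbrIn G (newNode hℓ 1 v) C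
  let Q : Finset V := Finset.univ.filter fun v => ∃ C', C' ≠ C ∧ NbrIn G (newNode hℓ 1 v) C'
  have hP : ∀ v, v ∈ P ↔ NbrIn G (newNode hℓ 1 v) C := fun v => by simp [P]
  have hQ : ∀ v, v ∈ Q ↔ ∃ C', C' ≠ C ∧ NbrIn G (newNode hℓ 1 v) C' := fun v => by simp [Q]
  have hcover : ∀ v, v ∈ P ∨ v ∈ Q := by
    intro v
    have hv : newNode hℓ 1 v ∉ S := fun h => Nat.not_succ_le_self ℓ (hS _ h)
    obtain ⟨y, hy, hadj⟩ := hdom _ hv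
    rw [hP, hQ]
    by_cases h : ((virtualGraph G L).induce S).connectedComponentMk ⟨y, hy⟩ = C
    · exact Or.inl ⟨⟨y, hy⟩, h, hadj⟩
    · exact Or.inr ⟨_, h, ⟨y, hy⟩, rfl, hadj⟩
  obtain ⟨y, hy⟩ := C.exists_rep
  obtain ⟨z, hz⟩ := C₁.exists_rep
  obtain ⟨T, hT, hT1, hT2, hcard⟩ := exists_matching_of_cover (G := G) hk hcover
    (p := realNode y.1) (q := realNode z.1)
    (fun v hv => (hP v).2 ((nbrIn_newNode_iff hS hℓ 1 v C).2 ⟨y, hy, hv⟩))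
    (fun v hv => (hQ v).2 ⟨C₁, hC₁, (nbrIn_newNode_iff hS hℓ 1 v C₁).2 ⟨z, hz, hv⟩⟩)
  -- If both `P ∩ Q` and `T` had fewer than `s` elements, then `k ≤ 3(s - 1)`, against `4s ≤ k + 3`.
  by_cases hshort : s ≤ (P ∩ Q).card
  · obtain ⟨T', hT', rfl⟩ := Finset.exists_subset_card_eq hshort
    have hinj : Function.Injective fun v : V => ((none : Option V), newNode hℓ 0 v) := by
      intro v v' h
      simpa [newNode] using h
    refine ⟨T'.image fun v => (none, newNode hℓ 0 v), ?_, Finset.card_image_of_injective _ hinj,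
      ?_, ?_⟩
    · intro e he
      obtain ⟨v, hv, rfl⟩ := Finset.mem_image.1 he
      obtain ⟨h1, h2⟩ := Finset.mem_inter.1 (hT' hv)
      obtain ⟨C', hC', h2⟩ := (hQ v).1 h2
      exact Or.inl ⟨isNew_newNode hℓ 0 v, rfl, (hr 0 1 v C).2 ((hP v).1 h1), C', hC',
        (hr 0 1 v C').2 h2⟩
    · intro e he e' he' h
      obtain ⟨v, -, rfl⟩ := Finset.mem_image.1 (Finset.mem_coe.1 he)
      obtain ⟨v', -, rfl⟩ := Finset.mem_image.1 (Finset.mem_coe.1 he')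
      exact Prod.ext rfl h
    · intro e he e' _ v h
      obtain ⟨v, -, rfl⟩ := Finset.mem_image.1 he
      simp at h
  · have hlong : s ≤ T.card := by omega
    obtain ⟨T', hT', rfl⟩ := Finset.exists_subset_card_eq hlong
    have hinj : Function.Injective fun p : V × V => (some p.1, newNode hℓ 2 p.2) := by
      intro p p' h
      simp only [newNode, Prod.mk.injEq, Option.some.injEq, and_true] at h
      exact Prod.ext h.1 h.2
    refine ⟨T'.image fun p => (some p.1, newNode hℓ 2 p.2), ?_,
      Finset.card_image_of_injective _ hinj, ?_, ?_⟩
    · intro e he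
      obtain ⟨p, hp, rfl⟩ := Finset.mem_image.1 he
      obtain ⟨h1, h2, h3, h4⟩ := hT p (hT' hp)
      obtain ⟨C', hC', h2⟩ := (hQ _).1 h2
      refine Or.inr ⟨isNew_newNode hℓ 2 p.2, p.1, rfl, ⟨fun h => ?_, Or.inr h4⟩, (hP _).1 h3, ?_,
        C', hC', (hr 2 1 _ _).2 h2⟩
      · simp [newNode] at h
      · intro C'' h
        by_contra hne
        exact h1 ((hQ _).2 ⟨C'', hne, h⟩)
    · intro e he e' he' h
      obtain ⟨p, hp, rfl⟩ := Finset.mem_image.1 (Finset.mem_coe.1 he)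
      obtain ⟨p', hp', rfl⟩ := Finset.mem_image.1 (Finset.mem_coe.1 he')
      simp only [newNode, Prod.mk.injEq, and_true] at h
      rw [hT2 (hT' hp) (hT' hp') h]
    · intro e he e' he' v h h'
      obtain ⟨p, hp, rfl⟩ := Finset.mem_image.1 he
      obtain ⟨p', hp', rfl⟩ := Finset.mem_image.1 he'
      simp only [Option.some.injEq] at h h'
      rw [hT1 (hT' hp) (hT' hp') (h.trans h'.symm)]

end Connectors

/-! ### Maximal matchings and the cover of active connectors -/

section Merge
variable {V : Type*} {L t : ℕ} {G : SimpleGraph V}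

/-- The component `C` of `S` lies in the same component of `S'` as another component of `S`. -/
def Merges {S S' : Set (VNode V L)} (h : S ⊆ S') (C : SetComp G S) : Prop :=
  ∃ C', C' ≠ C ∧ compMap (virtualGraph G L) h C' = compMap (virtualGraph G L) h C

theorem NbrIn.compMap_eq {S S' : Set (VNode V L)} (h : S ⊆ S') {x : VNode V L} (hx : x ∈ S')
    {C : SetComp G S} (hC : NbrIn G x C) : compMap (virtualGraph G L) h C =
      ((virtualGraph G L).induce S').connectedComponentMk ⟨x, hx⟩ := by
  obtain ⟨y, rfl, hxy⟩ := hC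
  exact compMap_mk_eq_of_adj h hx y hxy

theorem layerNo_of_isNew {ℓ r : ℕ} {x : VNode V L} (h : IsNew ℓ r x) : layerNo x ≤ ℓ + 1 := h.1.le

/-- A maximal matching has a vertex on every edge. -/
theorem mem_verts_or_of_adj {W : Type*} {H : SimpleGraph W} (M : MaximalMatching H) {p q : W}
    (h : H.Adj p q) : p ∈ M.1.verts ∨ q ∈ M.1.verts := by
  by_contra! hne
  have hmatch : (M.1 ⊔ H.subgraphOfAdj h).IsMatching := by
    refine SimpleGraph.Subgraph.IsMatching.sup M.2.1
      (SimpleGraph.Subgraph.IsMatching.subgraphOfAdj h) ?_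
    rw [SimpleGraph.Subgraph.IsMatching.support_eq_verts M.2.1,
      SimpleGraph.Subgraph.IsMatching.support_eq_verts
        (SimpleGraph.Subgraph.IsMatching.subgraphOfAdj h), Set.disjoint_left]
    intro x hx hx'
    rw [SimpleGraph.subgraphOfAdj_verts] at hx'
    rcases hx' with rfl | rfl
    exacts [hne.1 hx, hne.2 hx]
  have := (M.2.2 hmatch le_sup_left).1
  exact hne.1 (this (by simp))

theorem bridgingGraph_adj_inl {a : Assignment V L t} {ℓ : ℕ} {C : Σ i : Fin t, Comp G a ℓ i}
    {q : BridgeVertex G a ℓ} :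
    (bridgingGraph G a ℓ).Adj (Sum.inl C) q ↔ ∃ v, q = Sum.inr v ∧ Bridges G a ℓ C.2 v.1 := by
  unfold bridgingGraph
  rw [SimpleGraph.fromRel_adj]
  constructor
  · rintro ⟨-, ⟨C', v, h, rfl, hb⟩ | ⟨C', v, -, h, -⟩⟩
    · cases h
      exact ⟨v, rfl, hb⟩
    · cases h
  · rintro ⟨v, rfl, hb⟩
    exact ⟨Sum.inl_ne_inr, Or.inl ⟨C, v, rfl, rfl, hb⟩⟩

theorem MatchedTo.bridges {a : Assignment V L t} {ℓ : ℕ} {M : (bridgingGraph G a ℓ).Subgraph}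
    {C : Σ i : Fin t, Comp G a ℓ i} {x : VNode V L} (h : MatchedTo M C x) :
    Bridges G a ℓ C.2 x := by
  obtain ⟨hx, h⟩ := h
  obtain ⟨v, hv, hb⟩ := bridgingGraph_adj_inl.1 h.adj_sub
  cases hv
  exact hb

theorem MatchedTo.comp_unique {a : Assignment V L t} {ℓ : ℕ}
    {M : (bridgingGraph G a ℓ).Subgraph} (hM : M.IsMatching) {C C' : Σ i : Fin t, Comp G a ℓ i}
    {x : VNode V L} (h : MatchedTo M C x) (h' : MatchedTo M C' x) : C = C' := by
  obtain ⟨hx, h⟩ := h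
  obtain ⟨hx', h'⟩ := h'
  exact Sum.inl_injective (hM.eq_of_adj_right h h')

theorem MatchedTo.node_unique {a : Assignment V L t} {ℓ : ℕ}
    {M : (bridgingGraph G a ℓ).Subgraph} (hM : M.IsMatching) {C : Σ i : Fin t, Comp G a ℓ i}
    {x x' : VNode V L} (h : MatchedTo M C x) (h' : MatchedTo M C x') : x = x' := by
  obtain ⟨hx, h⟩ := h
  obtain ⟨hx', h'⟩ := h'
  exact congrArg Subtype.val (Sum.inr_injective (hM.eq_of_adj_left h h'))

theorem MatchedTo.joinMatched_eq {a : Assignment V L t} {ℓ : ℕ}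
    {M : (bridgingGraph G a ℓ).Subgraph} (hM : M.IsMatching) {C : Σ i : Fin t, Comp G a ℓ i}
    {x : VNode V L} (h : MatchedTo M C x) : joinMatched M x = some C.1 := by
  have hex : ∃ C, MatchedTo M C x := ⟨C, h⟩
  unfold joinMatched
  rw [dif_pos hex, MatchedTo.comp_unique hM hex.choose_spec h]

/-- The active connectors are covered by the merged components and the matched type-2 nodes. -/
theorem exists_cover_of_step [Fintype V] {ℓ : ℕ} (hℓ : ℓ < L) {S : Fin t → Set (VNode V L)}
    {a₁ a' : Assignment V L t} (hS : classSet a₁ ℓ = S)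
    (M : MaximalMatching (bridgingGraph G a₁ ℓ))
    (h13 : ∀ x, IsNew ℓ 1 x ∨ IsNew ℓ 3 x → a' x = a₁ x)
    (hmatched : ∀ C x, MatchedTo M.1 C x → a' x = some C.1)
    (hsub : ∀ i, S i ⊆ classSet a' (ℓ + 1) i) :
    ∃ (Z₁ : Finset (Σ i, SetComp G (S i))) (Z₂ : Finset V), Z₂.card ≤ Z₁.card ∧
      (∀ C ∈ Z₁, Merges (hsub C.1) C.2) ∧
      ∀ C : Σ i, SetComp G (S i), ∀ e, IsConnector G hℓ C.2 e → a₁ e.2 = some C.1 →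
        C ∈ Z₁ ∨ ∃ v ∈ Z₂, e.1 = some v := by
  classical
  subst hS
  have : Fintype (Σ i, SetComp G (classSet a₁ ℓ i)) := Fintype.ofFinite _
  have hmem : ∀ (C : Σ i, SetComp G (classSet a₁ ℓ i)) x, MatchedTo M.1 C x →
      Merges (hsub C.1) C.2 := by
    intro C x hx
    obtain ⟨h1, -, w, hw, hwi, hadj, C', hC', h2⟩ := hx.bridges
    have hxS : x ∈ classSet a' (ℓ + 1) C.1 := ⟨layerNo_of_isNew hx.1, hmatched C x hx⟩
    have hwS : w ∈ classSet a' (ℓ + 1) C.1 :=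
      ⟨layerNo_of_isNew hw, (h13 w (Or.inr hw)).trans hwi⟩
    refine ⟨C', hC', ?_⟩
    rw [NbrIn.compMap_eq (hsub C.1) hxS h1, NbrIn.compMap_eq (hsub C.1) hwS h2]
    refine SimpleGraph.ConnectedComponent.sound (SimpleGraph.Adj.reachable ?_)
    exact hadj.symm
  have hmem1 : ∀ (C : Σ i, SetComp G (classSet a₁ ℓ i)) u, IsNew ℓ 1 u → a₁ u = some C.1 →
      NbrIn G u C.2 → (∃ C', C' ≠ C.2 ∧ NbrIn G u C') → Merges (hsub C.1) C.2 := by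
    rintro C u hu hui h1 ⟨C', hC', h2⟩
    have huS : u ∈ classSet a' (ℓ + 1) C.1 :=
      ⟨layerNo_of_isNew hu, (h13 u (Or.inl hu)).trans hui⟩
    refine ⟨C', hC', ?_⟩
    rw [NbrIn.compMap_eq (hsub C.1) huS h1, NbrIn.compMap_eq (hsub C.1) huS h2]
  refine ⟨Finset.univ.filter fun C => Merges (hsub C.1) C.2,
    Finset.univ.filter fun v => ∃ C, MatchedTo M.1 C (newNode hℓ 1 v), ?_, ?_, ?_⟩
  · refine Finset.card_le_card_of_forall_subsingleton
      (fun v C => MatchedTo M.1 C (newNode hℓ 1 v)) ?_ ?_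
    · intro v hv
      obtain ⟨C, hC⟩ := (Finset.mem_filter.1 hv).2
      exact ⟨C, Finset.mem_filter.2 ⟨Finset.mem_univ _, hmem C _ hC⟩, hC⟩
    · intro C _ v hv v' hv'
      exact congrArg realNode (MatchedTo.node_unique M.2.1 hv.2 hv'.2)
  · intro C hC
    exact (Finset.mem_filter.1 hC).2
  · rintro C ⟨o, x⟩ hconn hact
    simp only [Finset.mem_filter, Finset.mem_univ, true_and]
    rcases hconn with ⟨hx, -, h1, h2⟩ | ⟨hx, v, hv, hadj, h1, -, h2⟩
    · exact Or.inl (hmem1 C x hx hact h1 h2)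
    -- Either a type-1 node already merges `C`, or `C` and `v` are adjacent in the bridging graph
    -- and maximality makes one of them matched.
    by_cases hB : ∃ u, IsNew ℓ 1 u ∧ a₁ u = some C.1 ∧ NbrIn G u C.2 ∧
        ∃ C', C' ≠ C.2 ∧ NbrIn G u C'
    · obtain ⟨u, hu, hui, h3, h4⟩ := hB
      exact Or.inl (hmem1 C u hu hui h3 h4)
    have hb : Bridges G a₁ ℓ C.2 (newNode hℓ 1 v) := ⟨h1, hB, x, hx, hact, hadj, h2⟩
    have hbadj : (bridgingGraph G a₁ ℓ).Adj (Sum.inl C)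
        (Sum.inr ⟨newNode hℓ 1 v, isNew_newNode hℓ 1 v⟩) :=
      bridgingGraph_adj_inl.2 ⟨_, rfl, hb⟩
    rcases mem_verts_or_of_adj M hbadj with h | h
    · obtain ⟨q, hq, -⟩ := M.2.1 h
      obtain ⟨w, rfl, -⟩ := bridgingGraph_adj_inl.1 hq.adj_sub
      exact Or.inl (hmem C w.1 ⟨w.2, hq⟩)
    · obtain ⟨q, hq, -⟩ := M.2.1 h
      rcases q with C' | w
      · exact Or.inr ⟨v, ⟨C', isNew_newNode hℓ 1 v, hq.symm⟩, hv⟩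
      · have := hq.adj_sub
        simp [bridgingGraph] at this

end Merge

/-! ### Excess under merging -/

section Excess
variable {V : Type*} {L t : ℕ} {G : SimpleGraph V}

theorem HalfDominating.classSet_nonempty {a : Assignment V L t} (h : HalfDominating G a) {ℓ : ℕ}
    (hℓ : L / 2 ≤ ℓ) (hℓL : ℓ < L) (v : V) (i : Fin t) : (classSet a ℓ i).Nonempty := by
  by_contra hne
  rw [Set.not_nonempty_iff_eq_empty] at hne
  have hne' : classSet a (L / 2) i = ∅ := Set.subset_empty_iff.1 (hne ▸ classSet_mono a hℓ i)
  obtain ⟨y, hy, -⟩ := h i (v, ⟨ℓ, hℓL⟩, 0) (by simp [hne'])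
  rw [hne'] at hy
  exact hy

theorem HalfDominating.isDominating {a : Assignment V L t} (h : HalfDominating G a) {ℓ : ℕ}
    (hℓ : L / 2 ≤ ℓ) (i : Fin t) : IsDominating (virtualGraph G L) (classSet a ℓ i) := by
  intro x hx
  obtain ⟨y, hy, hxy⟩ := h i x fun h' => hx (classSet_mono a hℓ i h')
  exact ⟨y, classSet_mono a hℓ i hy, hxy⟩

variable [Fintype V]

theorem excess_eq (a : Assignment V L t) (ℓ : ℕ) :
    excess G a ℓ = (Nat.card (Σ i : Fin t, Comp G a ℓ i) : ℤ) - t := by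
  unfold excess
  rw [Nat.card_sigma, Finset.sum_sub_distrib]
  simp

/-- All classes are handled by one surjection between the disjoint unions of their components; the
`- t` in both excesses cancels. -/
theorem two_mul_excess_add_card_le {ℓ : ℕ} {S : Fin t → Set (VNode V L)} {b a' : Assignment V L t}
    (hS : classSet b ℓ = S) (hdom : ∀ i, IsDominating (virtualGraph G L) (S i))
    (hsub : ∀ i, S i ⊆ classSet a' (ℓ + 1) i) (Z : Finset (Σ i, SetComp G (S i)))
    (hZ : ∀ C ∈ Z, Merges (hsub C.1) C.2) :
    2 * excess G a' (ℓ + 1) + Z.card ≤ 2 * excess G b ℓ := by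
  classical
  subst hS
  have i1 : Fintype (Σ i, SetComp G (classSet b ℓ i)) := Fintype.ofFinite _
  have i2 : Fintype (Σ i, SetComp G (classSet a' (ℓ + 1) i)) := Fintype.ofFinite _
  rw [excess_eq, excess_eq]
  have key := two_mul_card_add_card_le (K' := Σ i, SetComp G (classSet a' (ℓ + 1) i))
    (fun C : Σ i, SetComp G (classSet b ℓ i) =>
      ⟨C.1, compMap (virtualGraph G L) (hsub C.1) C.2⟩) ?_ Z ?_
  · rw [← Nat.card_eq_fintype_card, ← Nat.card_eq_fintype_card] at key
    simp only [SetComp, Comp] at key ⊢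
    omega
  · rintro ⟨i, C⟩
    obtain ⟨C', rfl⟩ := compMap_surjective (hsub i) (fun x _ hx => hdom i x hx) C
    exact ⟨⟨i, C'⟩, rfl⟩
  · rintro ⟨i, C⟩ hC
    obtain ⟨C', hne, h⟩ := hZ _ hC
    refine ⟨⟨i, C'⟩, fun h' => hne (eq_of_heq (Sigma.mk.inj h').2), ?_⟩
    simp only at h ⊢
    rw [h]

theorem HalfDominating.excess_succ_le {a : Assignment V L t} (h : HalfDominating G a) {ℓ : ℕ}
    (hℓ : L / 2 ≤ ℓ) : excess G a (ℓ + 1) ≤ excess G a ℓ := by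
  have := two_mul_excess_add_card_le (G := G) (b := a) (a' := a) (ℓ := ℓ) rfl
    (fun i => h.isDominating hℓ i) (fun i => classSet_mono a (Nat.le_succ ℓ) i) ∅ (by simp)
  simp only [Finset.card_empty, Nat.cast_zero, add_zero] at this
  omega

theorem excess_nonneg {a : Assignment V L t} {ℓ : ℕ} (h : ∀ i, (classSet a ℓ i).Nonempty) :
    0 ≤ excess G a ℓ := by
  refine Finset.sum_nonneg fun i _ => ?_
  obtain ⟨x, hx⟩ := h i
  have : Nonempty (Comp G a ℓ i) := ⟨SimpleGraph.connectedComponentMk _ ⟨x, hx⟩⟩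
  have : 0 < Nat.card (Comp G a ℓ i) := Nat.card_pos
  omega

end Excess

/-! ### Success probability of one recursive step -/

section Step
variable {V : Type*} {L t : ℕ} {G : SimpleGraph V}

open scoped Classical in
/-- The assignment after the nodes of `S` have joined the classes `c`. -/
noncomputable def joinOn (S : Set (VNode V L)) (b : Assignment V L t) (c : VNode V L → Fin t) :
    Assignment V L t :=
  fun x => if x ∈ S then some (c x) else b x

/-- The assignment after the new nodes of types 1 and 3 have joined the classes `c`. -/
noncomputable def joinTypes (ℓ : ℕ) (b : Assignment V L t) (c : VNode V L → Fin t) :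
    Assignment V L t :=
  joinOn {x | IsNew ℓ 1 x ∨ IsNew ℓ 3 x} b c

theorem joinTypes_of_isNew {ℓ : ℕ} (b : Assignment V L t) (c : VNode V L → Fin t)
    {x : VNode V L} (hx : IsNew ℓ 1 x ∨ IsNew ℓ 3 x) : joinTypes ℓ b c x = some (c x) :=
  if_pos hx

theorem joinTypes_of_layerNo_le {ℓ : ℕ} (b : Assignment V L t) (c : VNode V L → Fin t)
    {x : VNode V L} (hx : layerNo x ≤ ℓ) : joinTypes ℓ b c x = b x :=
  if_neg fun h => by
    have := h.elim And.left And.left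
    omega

variable [Fintype V] [NeZero t]

/-- The second half of the recursive step, in which the type-2 new nodes join their classes. -/
noncomputable def matchStep (rule : MatchingRule G L t) (ℓ : ℕ) (a₁ : Assignment V L t) :
    PMF (Assignment V L t) :=
  (rule ℓ a₁).bind fun M =>
    joinRandom {x | IsNew ℓ 2 x ∧ ¬ ∃ C, MatchedTo M.1 C x} (joinMatched M.1)

open scoped Classical in
theorem recursiveStep_eq (rule : MatchingRule G L t) (ℓ : ℕ) (b : Assignment V L t) :
    recursiveStep rule ℓ b = ((PMF.uniformOfFintype (VNode V L → Fin t)).map (joinTypes ℓ b)).bind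
      (matchStep rule ℓ) := rfl

/-- Every outcome of the matching step merges a set of components which, together with as many
type-2 nodes, covers the active connectors. -/
theorem exists_cover_of_mem_support {ℓ : ℕ} (hℓ : ℓ < L) (rule : MatchingRule G L t)
    {b : Assignment V L t} {c : VNode V L → Fin t} {a' : Assignment V L t}
    (h : a' ∈ (matchStep rule ℓ (joinTypes ℓ b c)).support)
    (hdom : ∀ i, IsDominating (virtualGraph G L) (classSet b ℓ i)) :
    ∃ (Z₁ : Finset (Σ i, SetComp G (classSet b ℓ i))) (Z₂ : Finset V), Z₂.card ≤ Z₁.card ∧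
      2 * excess G a' (ℓ + 1) + Z₁.card ≤ 2 * excess G b ℓ ∧
      (∀ i, classSet b ℓ i ⊆ classSet a' (ℓ + 1) i) ∧
      classSet a' ℓ = classSet b ℓ ∧
      ∀ C : Σ i, SetComp G (classSet b ℓ i), ∀ e, IsConnector G hℓ C.2 e → c e.2 = C.1 →
        C ∈ Z₁ ∨ ∃ v ∈ Z₂, e.1 = some v := by
  rw [matchStep, PMF.mem_support_bind_iff] at h
  obtain ⟨M, -, h⟩ := h
  have hne2 : ∀ x, ¬ IsNew ℓ 2 x → a' x = joinTypes ℓ b c x := fun x hx => by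
    rw [mem_support_joinRandom h fun h' => hx h'.1, joinMatched_apply_of_not_isNew _ hx]
  have h13 : ∀ x, IsNew ℓ 1 x ∨ IsNew ℓ 3 x → a' x = joinTypes ℓ b c x := by
    refine fun x hx => hne2 x fun h2 => ?_
    have := h2.2
    rcases hx with hx | hx <;> have := hx.2 <;> omega
  have hold : ∀ x, layerNo x ≤ ℓ → a' x = b x := fun x hx => by
    rw [hne2 x fun h2 => ?_, joinTypes_of_layerNo_le b c hx]
    have := h2.1
    omega
  have hcl : classSet a' ℓ = classSet b ℓ := classSet_eq_of_eqOn hold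
  have hcl₁ : classSet (joinTypes ℓ b c) ℓ = classSet b ℓ :=
    classSet_eq_of_eqOn fun x hx => joinTypes_of_layerNo_le b c hx
  have hsub : ∀ i, classSet b ℓ i ⊆ classSet a' (ℓ + 1) i := fun i =>
    hcl ▸ classSet_mono a' (Nat.le_succ ℓ) i
  have hmatched : ∀ C x, MatchedTo M.1 C x → a' x = some C.1 := fun C x hx => by
    rw [mem_support_joinRandom h fun h' => h'.2 ⟨C, hx⟩, hx.joinMatched_eq M.2.1]
  obtain ⟨Z₁, Z₂, hcard, hmerge, hcover⟩ := exists_cover_of_step hℓ hcl₁ M h13 hmatched hsub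
  refine ⟨Z₁, Z₂, hcard, two_mul_excess_add_card_le rfl hdom hsub Z₁ hmerge, hsub, hcl, ?_⟩
  intro C e he hc
  exact hcover C e he (by rw [joinTypes_of_isNew b c he.isNew, hc])

open scoped Classical in
/-- The average number of merged components is proportional to the excess, in the form of a
lower bound that depends on the classes of the new nodes of types 1 and 3 only. -/
theorem exists_merge_bound {ℓ : ℕ} (hℓ : ℓ < L) (hk : 0 < vertexConnectivity G)
    {b : Assignment V L t} (hdom : ∀ i, IsDominating (virtualGraph G L) (classSet b ℓ i)) {s : ℕ}
    (hs : 4 * s ≤ vertexConnectivity G + 3) (hst : s ≤ t) :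
    ∃ Φ : (VNode V L → Fin t) → ℝ,
      (∀ c (Z₁ : Finset (Σ i, SetComp G (classSet b ℓ i))) (Z₂ : Finset V),
        (∀ C : Σ i, SetComp G (classSet b ℓ i), ∀ e, IsConnector G hℓ C.2 e → c e.2 = C.1 →
          C ∈ Z₁ ∨ ∃ v ∈ Z₂, e.1 = some v) → Φ c ≤ Z₁.card + Z₂.card) ∧
      (s / (4 * t) * excess G b ℓ * Fintype.card (VNode V L → Fin t) : ℝ) ≤ ∑ c, Φ c := by
  classical
  have hfin : ∀ i, Fintype (SetComp G (classSet b ℓ i)) := fun i => Fintype.ofFinite _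
  have hconn : ∀ C : Σ i, SetComp G (classSet b ℓ i),
      ∃ E : Finset (Option V × VNode V L), (∀ e ∈ E, IsConnector G hℓ C.2 e) ∧ E.card ≤ t ∧
        ((∃ C', C' ≠ C.2) → E.card = s) ∧
        Set.InjOn Prod.snd (E : Set (Option V × VNode V L)) ∧
        ∀ e ∈ E, ∀ e' ∈ E, ∀ v, e.1 = some v → e'.1 = some v → e = e' := by
    intro C
    by_cases hC : ∃ C', C' ≠ C.2
    · obtain ⟨E, h1, h2, h3, h4⟩ :=
        exists_connectors hk hℓ (fun y hy => hy.1) (hdom C.1) C.2 hC hs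
      exact ⟨E, h1, h2.trans_le hst, fun _ => h2, h3, h4⟩
    · exact ⟨∅, by simp, by simp, fun h => absurd h hC, by simp, by simp⟩
  choose Ec hEc hEt hEs hE2 hE1 using hconn
  let E : Finset (Σ _ : (Σ i, SetComp G (classSet b ℓ i)), Option V × VNode V L) :=
    Finset.univ.sigma Ec
  -- The hypergraph has components and type-2 nodes as vertices; a connector is an edge at its
  -- component and at the type-2 node it needs, if any.
  let D : (Σ i, SetComp G (classSet b ℓ i)) ⊕ V →
      Finset (Σ _ : (Σ i, SetComp G (classSet b ℓ i)), Option V × VNode V L) :=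
    Sum.elim (fun C => E.filter fun e => e.1 = C) (fun v => E.filter fun e => e.2.1 = some v)
  have hmemE : ∀ e, e ∈ E ↔ e.2 ∈ Ec e.1 := fun e => by simp [E]
  have hinl : ∀ C, D (Sum.inl C) = E.filter fun e => e.1 = C := fun C => rfl
  have hinr : ∀ v, D (Sum.inr v) = E.filter fun e => e.2.1 = some v := fun v => rfl
  have hcol : ∀ v, Set.InjOn (fun e : (Σ _ : (Σ i, SetComp G (classSet b ℓ i)),
      Option V × VNode V L) => e.1.1) ↑(D (Sum.inr v)) := by
    rintro v ⟨⟨i, C⟩, e⟩ he ⟨⟨j, C'⟩, e'⟩ he' hij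
    rw [Finset.mem_coe, hinr, Finset.mem_filter, hmemE] at he he'
    simp only at hij he he'
    subst hij
    obtain rfl : C = C' := (hEc _ _ he.1).comp_eq (hEc _ _ he'.1) he.2 he'.2
    rw [hE1 _ _ he.1 _ he'.1 v he.2 he'.2]
  have hDt : ∀ p, (D p).card ≤ t := by
    rintro (C | v)
    · refine le_trans ?_ (hEt C)
      refine Finset.card_le_card_of_injOn (fun e => e.2) ?_ ?_
      · rintro ⟨C', e⟩ he
        rw [Finset.mem_coe, hinl, Finset.mem_filter, hmemE] at he
        obtain ⟨he, rfl⟩ := he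
        exact he
      · rintro ⟨C', e⟩ he ⟨C'', e'⟩ he' h
        rw [Finset.mem_coe, hinl, Finset.mem_filter] at he he'
        obtain ⟨-, rfl⟩ := he
        obtain ⟨-, rfl⟩ := he'
        simp only at h
        rw [h]
    · have := Finset.card_le_card_of_injOn (t := Finset.univ) _
        (fun _ _ => Finset.mem_coe.2 (Finset.mem_univ _)) (hcol v)
      simpa using this
  have hDpair : ∀ p, ∀ e ∈ D p, ∀ e' ∈ D p, e ≠ e' → e.2.2 ≠ e'.2.2 ∨ e.1.1 ≠ e'.1.1 := by
    rintro (C | v) e he e' he' hne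
    · left
      obtain ⟨C₁, e⟩ := e
      obtain ⟨C₂, e'⟩ := e'
      rw [hinl, Finset.mem_filter, hmemE] at he he'
      obtain ⟨he, rfl⟩ := he
      obtain ⟨he', h⟩ := he'
      simp only at h he he'
      subst h
      intro h
      exact hne (by rw [hE2 _ he he' h])
    · exact Or.inr fun h => hne (hcol v he he' h)
  have hDsum : ∑ p, (D p).card ≤ 2 * E.card := by
    rw [Fintype.sum_sum_type, two_mul]
    refine add_le_add ?_ ?_
    · exact (Finset.card_eq_sum_card_fiberwise (s := E) (f := fun e => e.1) (t := Finset.univ)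
        (fun _ _ => Finset.mem_coe.2 (Finset.mem_univ _))).ge
    · rw [Finset.card_eq_sum_card_fiberwise (s := E) (f := fun e => e.2.1) (t := Finset.univ)
        (fun _ _ => Finset.mem_coe.2 (Finset.mem_univ _)), Fintype.sum_option]
      exact Nat.le_add_left _ _
  obtain ⟨Φ, hΦ, havg⟩ := exists_cover_bound E (fun e => e.2.2) (fun e => e.1.1) D
    hDt hDpair hDsum
  refine ⟨Φ, ?_, ?_⟩
  · intro c Z₁ Z₂ hZ
    have := hΦ c (Z₁.disjSum Z₂) ?_
    · rw [Finset.card_disjSum] at this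
      exact_mod_cast this
    · intro e he hact
      rcases hZ e.1 e.2 (hEc _ _ ((hmemE e).1 he)) hact with h | ⟨v, hv, h⟩
      · exact ⟨Sum.inl e.1, Finset.inl_mem_disjSum.2 h, by simp [hinl, he]⟩
      · exact ⟨Sum.inr v, Finset.inr_mem_disjSum.2 hv, by simp [hinr, he, h]⟩
  · refine le_trans ?_ havg
    -- A class with `N ≥ 2` components has `s * N ≥ s * (N - 1)` chosen connectors; otherwise `N - 1
    -- ≤ 0`.
    have hcard : (s * excess G b ℓ : ℝ) ≤ E.card := by
      have h1 : ∀ i, (s : ℤ) * ((Nat.card (Comp G b ℓ i) : ℤ) - 1) ≤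
          ∑ C : SetComp G (classSet b ℓ i), ((Ec ⟨i, C⟩).card : ℤ) := by
        intro i
        have hnn : (0 : ℤ) ≤ ∑ C : SetComp G (classSet b ℓ i), ((Ec ⟨i, C⟩).card : ℤ) :=
          Finset.sum_nonneg fun C _ => Nat.cast_nonneg _
        by_cases hN : Fintype.card (SetComp G (classSet b ℓ i)) ≤ 1
        · have : ((Nat.card (Comp G b ℓ i) : ℤ) - 1) ≤ 0 := by
            have := Nat.card_eq_fintype_card (α := SetComp G (classSet b ℓ i))
            simp only [SetComp, Comp] at this hN ⊢
            omega
          nlinarith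
        · rw [Finset.sum_congr rfl fun C _ => by
            rw [hEs ⟨i, C⟩ (Fintype.exists_ne_of_one_lt_card (not_le.1 hN) C)]]
          rw [Finset.sum_const, Finset.card_univ, nsmul_eq_mul, ← Nat.card_eq_fintype_card]
          simp only [SetComp, Comp]
          nlinarith
      have h2 : (s : ℤ) * excess G b ℓ ≤ E.card := by
        unfold excess
        rw [Finset.mul_sum, Finset.card_sigma, Nat.cast_sum, Fintype.sum_sigma]
        exact Finset.sum_le_sum fun i _ => h1 i
      exact_mod_cast h2
    refine mul_le_mul_of_nonneg_right ?_ (Nat.cast_nonneg _)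
    rw [div_mul_eq_mul_div]
    exact div_le_div_of_nonneg_right hcard (by positivity)

/-- The connectivity bounds the number of connectors in terms of the number of classes. -/
theorem exists_connector_count {c : ℝ} (hc : 0 < c) {k t : ℕ} (ht : 0 < t)
    (htk : (t : ℝ) ≤ c * k) :
    ∃ s : ℕ, 4 * s ≤ k + 3 ∧ s ≤ t ∧ min 1 (1 / (4 * c)) ≤ (s : ℝ) / t := by
  have ht' : (0 : ℝ) < t := by exact_mod_cast ht
  -- Here `(k + 3) / 4` is `k / 4` rounded up, so `k / 4` is a lower bound for it even when `k` is
  -- small.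
  refine ⟨min t ((k + 3) / 4), by omega, min_le_left _ _, ?_⟩
  rw [le_div_iff₀ ht']
  rcases min_choice t ((k + 3) / 4) with h | h <;> rw [h]
  · have := min_le_left 1 (1 / (4 * c))
    nlinarith
  · have h1 := min_le_right 1 (1 / (4 * c))
    have h2 : (k : ℝ) ≤ 4 * ((k + 3) / 4 : ℕ) := by
      have : k ≤ 4 * ((k + 3) / 4) := by omega
      exact_mod_cast this
    calc min 1 (1 / (4 * c)) * t ≤ 1 / (4 * c) * (c * k) := by gcongr
      _ = k / 4 := by field_simp
      _ ≤ _ := by linarith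

theorem stepBound (rule : MatchingRule G L t) {c : ℝ} (hc : 0 < c)
    (ht : (t : ℝ) ≤ c * vertexConnectivity G) :
    StepBound rule (min 1 (1 / (4 * c)) / 32) (min 1 (1 / (4 * c)) / 32) := by
  classical
  intro ℓ hℓ b hb
  obtain ⟨hℓ1, hℓ2⟩ := Finset.mem_Ico.1 hℓ
  have htpos : 0 < t := NeZero.pos t
  have hk : 0 < vertexConnectivity G := by
    by_contra h
    have h0 : vertexConnectivity G = 0 := by omega
    rw [h0] at ht
    have : (0 : ℝ) < t := by exact_mod_cast htpos
    simp at ht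
    omega
  obtain ⟨v⟩ : Nonempty V := Fintype.card_pos_iff.1 (by
    have := (vertexConnectivity_spec hk).1
    omega)
  have hdom : ∀ i, IsDominating (virtualGraph G L) (classSet b ℓ i) := hb.isDominating hℓ1
  obtain ⟨s, hsk, hst, hs⟩ := exists_connector_count hc htpos ht
  obtain ⟨Φ, hΦ, havg⟩ := exists_merge_bound hℓ2 hk hdom hsk hst
  set κ := min 1 (1 / (4 * c)) with hκdef
  have hκ : 0 < κ := lt_min one_pos (by positivity)
  set X : ℝ := (excess G b ℓ : ℝ) with hXdef
  have hX0 : 0 ≤ X := by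
    have := excess_nonneg (G := G) (fun i => hb.classSet_nonempty hℓ1 hℓ2 v i)
    rw [hXdef]
    exact_mod_cast this
  rw [layerStep, if_neg (by omega), recursiveStep_eq]
  have hout : ∀ c', ∀ a' ∈ (matchStep rule ℓ (joinTypes ℓ b c')).support,
      ∃ z : ℝ, 0 ≤ z ∧ Φ c' ≤ 2 * z ∧ z ≤ 2 * X ∧ 2 * (excess G a' (ℓ + 1) : ℝ) + z ≤ 2 * X ∧
        (excess G a' ℓ : ℝ) = X := by
    intro c' a' ha'
    obtain ⟨Z₁, Z₂, hcard, hex, hsub, hcl, hcover⟩ := exists_cover_of_mem_support hℓ2 rule ha' hdom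
    have h1 := hΦ c' Z₁ Z₂ hcover
    have h2 : (Z₂.card : ℝ) ≤ Z₁.card := by exact_mod_cast hcard
    have h3 : 2 * (excess G a' (ℓ + 1) : ℝ) + Z₁.card ≤ 2 * X := by rw [hXdef]; exact_mod_cast hex
    have h4 : (0 : ℝ) ≤ excess G a' (ℓ + 1) := by
      have := excess_nonneg (G := G)
        (fun i => (hb.classSet_nonempty hℓ1 hℓ2 v i).mono (hsub i))
      exact_mod_cast this
    exact ⟨Z₁.card, Nat.cast_nonneg _, by linarith, by linarith, h3, by rw [excess_congr G hcl]⟩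
  -- Ask that the classes of types 1 and 3 force success for every outcome of the matching step.
  refine le_trans ?_ (prob_le_prob_bind _ _
    (A := {a₁ | ∀ a' ∈ (matchStep rule ℓ a₁).support, Success G (κ / 32) a' ℓ}) fun a h => h)
  rw [prob_map, prob_uniformOfFintype, le_div_iff₀ (by exact_mod_cast Fintype.card_pos)]
  -- With zero excess every outcome succeeds; the averaging argument needs a positive excess.
  rcases hX0.eq_or_lt with hX | hX
  · rw [Finset.filter_true_of_mem]
    · rw [Finset.card_univ]
      have : κ ≤ 1 := min_le_left _ _
      nlinarith [(Nat.cast_nonneg (Fintype.card (VNode V L → Fin t)) : (0 : ℝ) ≤ _)]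
    · intro c' _ a' ha'
      obtain ⟨z, hz, -, -, h1, h2⟩ := hout c' a' ha'
      unfold Success
      rw [h2, ← hX]
      linarith
  · have hub : ∀ c', Φ c' ≤ 4 * X := by
      intro c'
      obtain ⟨a', ha'⟩ := (matchStep rule ℓ (joinTypes ℓ b c')).support_nonempty
      obtain ⟨z, -, h1, h2, -, -⟩ := hout c' a' ha'
      linarith
    have havg' : κ / 4 * X * Fintype.card (VNode V L → Fin t) ≤ ∑ c', Φ c' := by
      refine le_trans ?_ havg
      have : κ / 4 ≤ s / (4 * t) := by
        rw [mul_comm (4 : ℝ), ← div_div]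
        linarith
      gcongr
    -- The fraction obtained is `α / 8 = κ / 32`. On it `Φ ≥ κX / 8`, so at least `κX / 16`
    -- components merge and the excess drops by at least `κX / 32`.
    have key := card_filter_of_average Φ (α := κ / 4) (by positivity) hX hub havg'
      (S := joinTypes ℓ b ⁻¹' {a₁ | ∀ a' ∈ (matchStep rule ℓ a₁).support,
        Success G (κ / 32) a' ℓ}) ?_
    · refine le_trans (le_of_eq ?_) key
      ring
    · intro c' hc' a' ha'
      obtain ⟨z, -, h1, -, h2, h3⟩ := hout c' a' ha'
      unfold Success
      rw [h3]
      nlinarith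

end Step

end FastMerger

theorem mainTheorem9 (c : ℝ) (hc : 0 < c) :
    ∃ δ ρ : ℝ, 0 < δ ∧ 0 < ρ ∧ ρ ≤ 1 ∧
      ∀ (V : Type*) [Fintype V] (G : SimpleGraph V) (L t : ℕ) [NeZero t]
        (_ht : (t : ℝ) ≤ c * (FastMerger.vertexConnectivity G : ℝ))
        (rule : FastMerger.MatchingRule G L t),
        -- the excess never increases
        (∀ a ∈ (FastMerger.run rule L).support, FastMerger.HalfDominating G a →
          ∀ ℓ ∈ Finset.Ico (L / 2) L,
            FastMerger.excess G a (ℓ + 1) ≤ FastMerger.excess G a ℓ) ∧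
        -- each step succeeds with probability at least `ρ`, given any history `b` of the
        -- layers `1, …, ℓ`
        (∀ ℓ ∈ Finset.Ico (L / 2) L, ∀ b : FastMerger.Assignment V L t,
          FastMerger.HalfDominating G b →
          ρ * FastMerger.prob (FastMerger.run rule L) {a | FastMerger.upTo a ℓ = b} ≤
            FastMerger.prob (FastMerger.run rule L)
              {a | FastMerger.upTo a ℓ = b ∧ FastMerger.Success G δ a ℓ}) ∧
        -- given domination, the successes of the steps stochastically dominate independent
        -- trials with success probability `ρ`
        (∀ U : Set (Finset ℕ), IsUpperSet U →
          FastMerger.independentTrials ρ (Finset.Ico (L / 2) L) U *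
              FastMerger.prob (FastMerger.run rule L) {a | FastMerger.HalfDominating G a} ≤
            FastMerger.prob (FastMerger.run rule L)
              {a | FastMerger.HalfDominating G a ∧ FastMerger.successSet G δ a ∈ U}) := by
  have hκ : 0 < min 1 (1 / (4 * c)) := lt_min one_pos (by positivity)
  have hκ1 : min 1 (1 / (4 * c)) ≤ 1 := min_le_left _ _
  refine ⟨min 1 (1 / (4 * c)) / 32, min 1 (1 / (4 * c)) / 32, by positivity, by positivity,
    by linarith, ?_⟩
  intro V _ G L t _ ht rule
  have hstep := FastMerger.stepBound rule hc ht
  refine ⟨fun a _ ha ℓ hℓ => ha.excess_succ_le (Finset.mem_Ico.1 hℓ).1,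
    fun ℓ hℓ b hb => hstep.history hℓ hb, fun U hU => ?_⟩
  exact hstep.dominates (by positivity) (by linarith) (Nat.div_le_self L 2) le_rfl U hU
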